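/- Let $K$ be an algebraically closed field of characteristic zero and $\ell$ a finite-dimensional Lie algebra over $K$, with basis $\{u\}$ and dual basis $\{u'\}$ of $\ell'$. Let the Clifford algebra be generated by $b_n^u, c_n^{u'}$ and the Weyl algebra by $\beta_n^u,\gamma_n^{u'}$ ($n\in\mathbb Z$), subject to $$c_n^{u'}b_m^v+b_m^vc_n^{u'}=\langle u',v\rangle\delta_{n+m,0},\qquad \gamma_n^{u'}\beta_m^v-\beta_m^v\gamma_n^{u'}=\langle u',v\rangle\delta_{n+m,0},$$ while any two $b$'s and any two $c$'s anticommute, and any two $\beta$'s and any two $\gamma$'s commute; write $b_n^x,\beta_n^x$ for the linear extensions to $x\in\ell$. The creation operators are $b_n^u,\beta_n^u$ with $n\le -1$ and $c_n^{u'},\gamma_n^{u'}$ with $n\le 0$; the other generators are annihilation operators. Let $W=W^{\infty/2}\tilde\ell$ be the tensor product of the modules over the Weyl and Clifford algebras induced from the trivial one-dimensional modules of the subalgebras generated by the annihilation operators. Let $:\;:$ denote normal ordering (annihilation operators are moved to the right, with a sign for each exchange of two odd generators; $b,c$ are odd and $\beta,\gamma$ are even). On $W$ consider the following operators, given by sums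 of which only finitely many terms act nontrivially on any given vector: $$L_n=-\sum_{u,m}m:b_{n+m}^uc_{-m}^{u'}:-\sum_{u,m}m:\beta_{n+m}^u\gamma_{-m}^{u'}:\,,$$ $$\theta(x_n)=\sum_{v,m}:\beta_{n+m}^{[x,v]}\gamma_{-m}^{v'}:+\sum_{v,m}:b_{n+m}^{[x,v]}c_{-m}^{v'}:\qquad(x\in\ell,\ n\in\mathbb Z),$$ $$Q=\sum_{u,v;\,i,j}:\beta_{i+j}^{[u,v]}\gamma_{-i}^{v'}c_{-j}^{u'}:+\frac12\sum_{u,v;\,i,j}:b_{i+j}^{[u,v]}c_{-i}^{v'}c_{-j}^{u'}:\,,$$ $$h=\sum_{u,n}\gamma_{-n}^{u'}b_n^u,\qquad k=\sum_{u,n}n\,\beta_n^uc_{-n}^{u'},$$ where $u,v$ run over the basis and $i,j,m,n$ in the sums over $\mathbb Z$. Then $$Qh+hQ=0,\quad Qk+kQ=0,\quad hk+kh=-L_0,\quad Q^2=h^2=k^2=0,$$ $$hL_n=L_nh\ \ (n\in\mathbb Z),\quad kL_0=L_0k,\quad h\,\theta(x_n)=\theta(x_n)\,h\ \ (x\in\ell,\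 n\in\mathbb Z),\quad k\,\theta(x_0)=\theta(x_0)\,k\ \ (x\in\ell).$$ -/

import Mathlib

/-! The semi-infinite Weil complex of the loop algebra of a finite dimensional Lie algebra `ℓ`
over a field `K`, with its standard vacuum, and the operators acting on it. -/

namespace VOWA

open scoped TensorProduct

/-- Symbols indexed by a basis of `ℓ` and an integer: `vec u n` stands for `b_n^u` or `β_n^u`,
and `cov u n` stands for `c_n^{u'}` or `γ_n^{u'}`. -/
inductive Gen (ι : Type*)
  | vec (u : ι) (n : ℤ)
  | cov (u : ι) (n : ℤ)

namespace Gen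

/-- Creation operators: `b_n, β_n` with `n ≤ -1` and `c_n, γ_n` with `n ≤ 0`. -/
def IsCreation {ι : Type*} : Gen ι → Prop
  | vec _ n => n ≤ -1
  | cov _ n => n ≤ 0

/-- The index `n` of a symbol. -/
def idx {ι : Type*} : Gen ι → ℤ
  | vec _ n => n
  | cov _ n => n

end Gen

section Algebra

variable (K : Type*) [Field K] (ι : Type*)

open Classical in
/-- `⟨u', v⟩ δ_{n+m,0}` for elements `u`, `v` of a basis. -/
noncomputable def pairing (u : ι) (n : ℤ) (v : ι) (m : ℤ) : K :=
  if u = v ∧ n + m = 0 then 1 else 0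

/-- The defining relations. With `ε = 1` these are the Weyl relations for `β, γ`
(commutators), with `ε = -1` the Clifford relations for `b, c` (anticommutators). -/
inductive Rel (ε : ℤˣ) : FreeAlgebra K (Gen ι) → FreeAlgebra K (Gen ι) → Prop
  | cov_vec (u v : ι) (n m : ℤ) : Rel ε
      (FreeAlgebra.ι K (Gen.cov u n) * FreeAlgebra.ι K (Gen.vec v m)
        - (ε : ℤ) • (FreeAlgebra.ι K (Gen.vec v m) * FreeAlgebra.ι K (Gen.cov u n)))
      (algebraMap K _ (pairing K ι u n v m))
  | vec_vec (u v : ι) (n m : ℤ) : Rel ε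
      (FreeAlgebra.ι K (Gen.vec u n) * FreeAlgebra.ι K (Gen.vec v m)
        - (ε : ℤ) • (FreeAlgebra.ι K (Gen.vec v m) * FreeAlgebra.ι K (Gen.vec u n))) 0
  | cov_cov (u v : ι) (n m : ℤ) : Rel ε
      (FreeAlgebra.ι K (Gen.cov u n) * FreeAlgebra.ι K (Gen.cov v m)
        - (ε : ℤ) • (FreeAlgebra.ι K (Gen.cov v m) * FreeAlgebra.ι K (Gen.cov u n))) 0

/-- The Weyl algebra (`ε = 1`) or the Clifford algebra (`ε = -1`). -/
abbrev OscAlg (ε : ℤˣ) : Type _ := RingQuot (Rel K ι ε)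

/-- A generator of the Weyl or Clifford algebra. -/
noncomputable def gen (ε : ℤˣ) (g : Gen ι) : OscAlg K ι ε :=
  RingQuot.mkAlgHom K (Rel K ι ε) (FreeAlgebra.ι K g)

/-- The left ideal generated by the annihilation operators. -/
noncomputable def annIdeal (ε : ℤˣ) : Submodule (OscAlg K ι ε) (OscAlg K ι ε) :=
  Submodule.span (OscAlg K ι ε) {a | ∃ g : Gen ι, ¬ g.IsCreation ∧ a = gen K ι ε g}

/-- The module induced from the trivial representation of the subalgebra generated by the
annihilation operators; the class of `1` is the vacuum. For `ε = 1` it is the semi-infinite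
symmetric module, for `ε = -1` the semi-infinite exterior module. -/
def Fock (ε : ℤˣ) : Type _ := OscAlg K ι ε ⧸ annIdeal K ι ε

noncomputable instance (ε : ℤˣ) : AddCommGroup (Fock K ι ε) :=
  inferInstanceAs (AddCommGroup (OscAlg K ι ε ⧸ annIdeal K ι ε))

noncomputable instance (ε : ℤˣ) : Module (OscAlg K ι ε) (Fock K ι ε) :=
  inferInstanceAs (Module (OscAlg K ι ε) (OscAlg K ι ε ⧸ annIdeal K ι ε))

noncomputable instance (ε : ℤˣ) : Module K (Fock K ι ε) :=
  inferInstanceAs (Module K (OscAlg K ι ε ⧸ annIdeal K ι ε))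

instance (ε : ℤˣ) : IsScalarTower K (OscAlg K ι ε) (Fock K ι ε) :=
  inferInstanceAs (IsScalarTower K (OscAlg K ι ε) (OscAlg K ι ε ⧸ annIdeal K ι ε))

/-- The class of an element of the algebra in the induced module. -/
noncomputable def mk (ε : ℤˣ) : OscAlg K ι ε →ₗ[OscAlg K ι ε] Fock K ι ε :=
  (annIdeal K ι ε).mkQ

/-- The action of the Weyl or Clifford algebra on the induced module. -/
noncomputable def act (ε : ℤˣ) : OscAlg K ι ε →ₐ[K] Module.End K (Fock K ι ε) :=
  Algebra.lsmul K K (Fock K ι ε)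

/-- The semi-infinite Weil complex: semi-infinite symmetric module tensor semi-infinite
exterior module. -/
abbrev W : Type _ := TensorProduct K (Fock K ι 1) (Fock K ι (-1))

/-- The action of the Weyl algebra on the first factor. -/
noncomputable def weyl : OscAlg K ι 1 →ₐ[K] Module.End K (W K ι) :=
  (Module.End.rTensorAlgHom K (Fock K ι 1) (Fock K ι (-1))).comp (act K ι 1)

/-- The action of the Clifford algebra on the second factor. -/
noncomputable def cliff : OscAlg K ι (-1) →ₐ[K] Module.End K (W K ι) :=
  (Module.End.lTensorAlgHom K (Fock K ι (-1)) (Fock K ι 1)).comp (act K ι (-1))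


/-! Every vector is killed by all modes of sufficiently high index. -/

variable {K ι}

theorem gen_cov_vec (ε : ℤˣ) (u v : ι) (n m : ℤ) :
    gen K ι ε (.cov u n) * gen K ι ε (.vec v m)
      = (ε : ℤ) • (gen K ι ε (.vec v m) * gen K ι ε (.cov u n))
        + algebraMap K _ (pairing K ι u n v m) := by
  have h := RingQuot.mkAlgHom_rel K (Rel.cov_vec (K := K) (ε := ε) u v n m)
  simp only [map_sub, map_mul, map_zsmul, AlgHom.commutes] at h
  rw [← sub_eq_iff_eq_add']
  exact h

theorem gen_vec_vec (ε : ℤˣ) (u v : ι) (n m : ℤ) :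
    gen K ι ε (.vec u n) * gen K ι ε (.vec v m)
      = (ε : ℤ) • (gen K ι ε (.vec v m) * gen K ι ε (.vec u n)) := by
  have h := RingQuot.mkAlgHom_rel K (Rel.vec_vec (K := K) (ε := ε) u v n m)
  simp only [map_sub, map_mul, map_zsmul, map_zero] at h
  exact sub_eq_zero.mp h

theorem gen_cov_cov (ε : ℤˣ) (u v : ι) (n m : ℤ) :
    gen K ι ε (.cov u n) * gen K ι ε (.cov v m)
      = (ε : ℤ) • (gen K ι ε (.cov v m) * gen K ι ε (.cov u n)) := by
  have h := RingQuot.mkAlgHom_rel K (Rel.cov_cov (K := K) (ε := ε) u v n m)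
  simp only [map_sub, map_mul, map_zsmul, map_zero] at h
  exact sub_eq_zero.mp h

theorem gen_swap (ε : ℤˣ) (g g' : Gen ι)
    (h : g.idx + g'.idx ≠ 0 ∨ (¬ g.IsCreation ∧ ¬ g'.IsCreation)) :
    gen K ι ε g * gen K ι ε g' = (ε : ℤ) • (gen K ι ε g' * gen K ι ε g) := by
  have key : ∀ (u v : ι) (n m : ℤ), n + m ≠ 0 → gen K ι ε (.cov u n) * gen K ι ε (.vec v m)
      = (ε : ℤ) • (gen K ι ε (.vec v m) * gen K ι ε (.cov u n)) := by
    intro u v n m hnm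
    rw [gen_cov_vec]
    simp [pairing, hnm]
  cases g with
  | vec u n =>
    cases g' with
    | vec v m => exact gen_vec_vec ε u v n m
    | cov v m =>
      simp only [Gen.idx, Gen.IsCreation] at h
      rw [key v u m n (by omega), smul_smul]
      simp
  | cov u n =>
    cases g' with
    | vec v m =>
      simp only [Gen.idx, Gen.IsCreation] at h
      exact key u v n m (by omega)
    | cov v m => exact gen_cov_cov ε u v n m

theorem fock_bound (ε : ℤˣ) (s : Fock K ι ε) :
    ∃ N : ℤ, ∀ g : Gen ι, N < g.idx → act K ι ε (gen K ι ε g) s = 0 := by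
  let P : Fock K ι ε → Prop := fun s =>
    ∃ N : ℤ, ∀ g : Gen ι, N < g.idx → act K ι ε (gen K ι ε g) s = 0
  have hadd : ∀ s t, P s → P t → P (s + t) := by
    rintro s t ⟨N, hN⟩ ⟨M, hM⟩
    refine ⟨max N M, fun g hg => ?_⟩
    rw [map_add, hN g (lt_of_le_of_lt (le_max_left _ _) hg),
      hM g (lt_of_le_of_lt (le_max_right _ _) hg), add_zero]
  have hsmul : ∀ (c : K) s, P s → P (c • s) := by
    rintro c s ⟨N, hN⟩
    exact ⟨N, fun g hg => by rw [map_smul, hN g hg, smul_zero]⟩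
  have hgen : ∀ g s, P s → P (act K ι ε (gen K ι ε g) s) := by
    rintro g s ⟨N, hN⟩
    refine ⟨max N (-g.idx), fun g' hg' => ?_⟩
    have h1 := lt_of_le_of_lt (le_max_left _ _) hg'
    have h2 := lt_of_le_of_lt (le_max_right _ _) hg'
    rw [← Module.End.mul_apply, ← map_mul, gen_swap ε g' g (Or.inl (by omega)), map_zsmul,
      map_mul, LinearMap.smul_apply, Module.End.mul_apply, hN g' h1, map_zero, smul_zero]
  have hall : ∀ (a : FreeAlgebra K (Gen ι)) s, P s →
      P (act K ι ε (RingQuot.mkAlgHom K (Rel K ι ε) a) s) := by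
    intro a
    induction a using FreeAlgebra.induction with
    | grade0 r =>
      intro s hs
      simpa [Algebra.algebraMap_eq_smul_one] using hsmul r s hs
    | grade1 g => exact hgen g
    | mul a b ha hb =>
      intro s hs
      rw [map_mul, map_mul]
      exact ha _ (hb _ hs)
    | add a b ha hb =>
      intro s hs
      rw [map_add, map_add]
      exact hadd _ _ (ha _ hs) (hb _ hs)
  obtain ⟨x, rfl⟩ := (annIdeal K ι ε).mkQ_surjective s
  change P (mk K ι ε x)
  obtain ⟨a, rfl⟩ := RingQuot.mkAlgHom_surjective K (Rel K ι ε) x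
  have hvac : P (mk K ι ε 1) := by
    refine ⟨0, fun g hg => ?_⟩
    change mk K ι ε (gen K ι ε g * 1) = _
    rw [mul_one]
    refine (Submodule.Quotient.mk_eq_zero _).mpr (Submodule.subset_span ⟨g, ?_, rfl⟩)
    cases g <;> simp only [Gen.idx, Gen.IsCreation] at * <;> omega
  have h := hall a _ hvac
  have e : act K ι ε (RingQuot.mkAlgHom K (Rel K ι ε) a) (mk K ι ε 1)
      = mk K ι ε (RingQuot.mkAlgHom K (Rel K ι ε) a) := by
    change mk K ι ε (_ * 1) = _
    rw [mul_one]
  rwa [e] at h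

/-- All modes of index greater than `N` kill `w`. -/
def Bounded (N : ℤ) (w : W K ι) : Prop :=
  ∀ g : Gen ι, N < g.idx →
    weyl K ι (gen K ι 1 g) w = 0 ∧ cliff K ι (gen K ι (-1) g) w = 0

theorem exists_bounded (w : W K ι) : ∃ N : ℤ, 0 ≤ N ∧ Bounded N w := by
  induction w using TensorProduct.induction_on with
  | zero => exact ⟨0, le_rfl, fun g _ => ⟨map_zero _, map_zero _⟩⟩
  | tmul s t =>
    obtain ⟨N, hN⟩ := fock_bound 1 s
    obtain ⟨M, hM⟩ := fock_bound (-1) t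
    refine ⟨max 0 (max N M), le_max_left _ _, fun g hg => ⟨?_, ?_⟩⟩
    · change (act K ι 1 (gen K ι 1 g) s) ⊗ₜ[K] t = 0
      rw [hN g (by omega), TensorProduct.zero_tmul]
    · change s ⊗ₜ[K] (act K ι (-1) (gen K ι (-1) g) t) = 0
      rw [hM g (by omega), TensorProduct.tmul_zero]
  | add x y hx hy =>
    obtain ⟨N, hN0, hN⟩ := hx
    obtain ⟨M, hM0, hM⟩ := hy
    refine ⟨max N M, by omega, fun g hg => ⟨?_, ?_⟩⟩
    · rw [map_add, (hN g (by omega)).1, (hM g (by omega)).1, add_zero]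
    · rw [map_add, (hN g (by omega)).2, (hM g (by omega)).2, add_zero]

theorem weyl_cliff_comm (x : OscAlg K ι 1) (y : OscAlg K ι (-1)) (w : W K ι) :
    weyl K ι x (cliff K ι y w) = cliff K ι y (weyl K ι x w) := by
  induction w using TensorProduct.induction_on with
  | zero => simp
  | tmul s t => rfl
  | add x y hx hy => simp only [map_add, hx, hy]

theorem bounded_weyl {N : ℤ} (hN : 0 ≤ N) {g : Gen ι} (hg : ¬ g.IsCreation) {w : W K ι}
    (hw : Bounded N w) : Bounded N (weyl K ι (gen K ι 1 g) w) := by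
  intro g' hg'
  have hc : ¬ g'.IsCreation := by
    cases g' <;> simp only [Gen.idx, Gen.IsCreation] at * <;> omega
  refine ⟨?_, ?_⟩
  · rw [← Module.End.mul_apply, ← map_mul, gen_swap 1 g' g (Or.inr ⟨hc, hg⟩), map_zsmul,
      map_mul, LinearMap.smul_apply, Module.End.mul_apply, (hw g' hg').1, map_zero, smul_zero]
  · rw [← weyl_cliff_comm, (hw g' hg').2, map_zero]

theorem bounded_cliff {N : ℤ} (hN : 0 ≤ N) {g : Gen ι} (hg : ¬ g.IsCreation) {w : W K ι}
    (hw : Bounded N w) : Bounded N (cliff K ι (gen K ι (-1) g) w) := by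
  intro g' hg'
  have hc : ¬ g'.IsCreation := by
    cases g' <;> simp only [Gen.idx, Gen.IsCreation] at * <;> omega
  refine ⟨?_, ?_⟩
  · rw [weyl_cliff_comm, (hw g' hg').1, map_zero]
  · rw [← Module.End.mul_apply, ← map_mul, gen_swap (-1) g' g (Or.inr ⟨hc, hg⟩), map_zsmul,
      map_mul, LinearMap.smul_apply, Module.End.mul_apply, (hw g' hg').2, map_zero, smul_zero]

theorem bounded_add {N : ℤ} {w w' : W K ι} (h : Bounded N w) (h' : Bounded N w') :
    Bounded N (w + w') := fun g hg => by
  simp [(h g hg).1, (h g hg).2, (h' g hg).1, (h' g hg).2]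

theorem bounded_smul {N : ℤ} {w : W K ι} (c : K) (h : Bounded N w) :
    Bounded N (c • w) := fun g hg => by
  simp [(h g hg).1, (h g hg).2]

theorem bounded_zero {N : ℤ} : Bounded N (0 : W K ι) := fun g _ => by simp

end Algebra

section Operators

variable {K : Type*} [Field K] {ℓ : Type*} [LieRing ℓ] [LieAlgebra K ℓ]
  {ι : Type*} [Fintype ι] (B : Module.Basis ι K ℓ)

/-- The modes `b_n^x, β_n^x` for `x ∈ ℓ` and `c_n^f, γ_n^f` for `f ∈ ℓ'`. -/
inductive Mode (K ℓ : Type*) [Field K] [LieRing ℓ] [LieAlgebra K ℓ]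
  | b (x : ℓ) (n : ℤ)
  | c (f : Module.Dual K ℓ) (n : ℤ)
  | β (x : ℓ) (n : ℤ)
  | γ (f : Module.Dual K ℓ) (n : ℤ)

namespace Mode

/-- The modes `b` and `c` are odd. -/
def IsOdd : Mode K ℓ → Bool
  | b _ _ => true
  | c _ _ => true
  | β _ _ => false
  | γ _ _ => false

/-- Creation operators. -/
def IsCreation : Mode K ℓ → Bool
  | b _ n => decide (n ≤ -1)
  | c _ n => decide (n ≤ 0)
  | β _ n => decide (n ≤ -1)
  | γ _ n => decide (n ≤ 0)

/-- The index of a mode. -/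
def idx : Mode K ℓ → ℤ
  | b _ n => n
  | c _ n => n
  | β _ n => n
  | γ _ n => n

end Mode

/-- The operator of a mode: `b_n^x` and `β_n^x` are linear in `x`, and `c_n^f`, `γ_n^f` are
linear in `f`. -/
noncomputable def op : Mode K ℓ → Module.End K (W K ι)
  | .b x n => ∑ u, B.repr x u • cliff K ι (gen K ι (-1) (.vec u n))
  | .c f n => ∑ u, f (B u) • cliff K ι (gen K ι (-1) (.cov u n))
  | .β x n => ∑ u, B.repr x u • weyl K ι (gen K ι 1 (.vec u n))
  | .γ f n => ∑ u, f (B u) • weyl K ι (gen K ι 1 (.cov u n))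

/-- The normally ordered product of a list of modes, by induction on the list: a creation
operator in front stays on the left, an annihilation operator is moved to the far right, with
a sign if both it and the product of the remaining modes are odd. -/
noncomputable def nord : List (Mode K ℓ) → Module.End K (W K ι)
  | [] => 1
  | a :: l =>
    if a.IsCreation then op B a * nord l
    else if a.IsOdd ∧ Odd (l.countP Mode.IsOdd) then - (nord l * op B a)
    else nord l * op B a

theorem op_eq_zero {N : ℤ} {w : W K ι} (hw : Bounded N w) (a : Mode K ℓ) (ha : N < a.idx) :
    op B a w = 0 := by
  cases a <;> simp only [op, LinearMap.sum_apply, LinearMap.smul_apply] <;>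
    refine Finset.sum_eq_zero fun u _ => ?_
  · rw [(hw (.vec u _) ha).2, smul_zero]
  · rw [(hw (.cov u _) ha).2, smul_zero]
  · rw [(hw (.vec u _) ha).1, smul_zero]
  · rw [(hw (.cov u _) ha).1, smul_zero]

theorem bounded_sum {N : ℤ} (f : ι → W K ι) (h : ∀ u, Bounded N (f u)) :
    Bounded N (∑ u, f u) := by
  classical
  refine Finset.sum_induction _ (Bounded N) (fun _ _ => bounded_add) bounded_zero fun u _ => h u

theorem bounded_op {N : ℤ} (hN : 0 ≤ N) {w : W K ι} (hw : Bounded N w) (a : Mode K ℓ)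
    (ha : ¬ a.IsCreation) : Bounded N (op B a w) := by
  cases a <;> simp only [op, LinearMap.sum_apply, LinearMap.smul_apply] <;>
    refine bounded_sum _ fun u => bounded_smul _ ?_
  · exact bounded_cliff hN (by simpa [Mode.IsCreation, Gen.IsCreation] using ha) hw
  · exact bounded_cliff hN (by simpa [Mode.IsCreation, Gen.IsCreation] using ha) hw
  · exact bounded_weyl hN (by simpa [Mode.IsCreation, Gen.IsCreation] using ha) hw
  · exact bounded_weyl hN (by simpa [Mode.IsCreation, Gen.IsCreation] using ha) hw

theorem nord_eq_zero {N : ℤ} (hN : 0 ≤ N) (l : List (Mode K ℓ)) :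
    ∀ {w : W K ι}, Bounded N w → (∃ a ∈ l, N < a.idx) → nord B l w = 0 := by
  induction l with
  | nil => rintro w _ ⟨a, ha, _⟩; simp at ha
  | cons a l ih =>
    rintro w hw ⟨x, hx, hxN⟩
    by_cases hc : a.IsCreation
    · have hxl : x ∈ l := by
        rcases List.mem_cons.mp hx with rfl | h
        · exfalso
          cases x <;> simp [Mode.IsCreation, Mode.idx] at hc hxN <;> omega
        · exact h
      simp [nord, hc, ih hw ⟨x, hxl, hxN⟩]
    · have key : nord B l (op B a w) = 0 := by
        rcases List.mem_cons.mp hx with rfl | h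
        · rw [op_eq_zero B hw x hxN, map_zero]
        · exact ih (bounded_op B hN hw a hc) ⟨x, h, hxN⟩
      simp only [nord, hc, Bool.false_eq_true, if_false]
      split_ifs <;> simp [key]

/-- A family of operators is locally finite if on each vector all but finitely many of them
vanish. -/
def LocFin {I : Type*} (T : I → Module.End K (W K ι)) : Prop :=
  ∀ w, {i | T i w ≠ 0}.Finite

/-- The sum of a locally finite family of operators. -/
noncomputable def locSum {I : Type*} (T : I → Module.End K (W K ι)) (hT : LocFin T) :
    Module.End K (W K ι) where
  toFun w := ∑ᶠ i, T i w
  map_add' w w' := by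
    simp only [map_add]
    exact finsum_add_distrib (hT w) (hT w')
  map_smul' a w := by
    simp only [map_smul, RingHom.id_apply]
    exact (smul_finsum' a (hT w)).symm

theorem locFin_two (p q : ι → ℤ → Mode K ℓ) (n : ℤ)
    (hp : ∀ u m, (p u m).idx = n + m) (hq : ∀ u m, (q u m).idx = -m) (r : ℤ → K) :
    LocFin fun i : ι × ℤ => r i.2 • nord B [p i.1 i.2, q i.1 i.2] := by
  intro w
  obtain ⟨N, hN, hw⟩ := exists_bounded w
  refine ((Set.finite_univ (α := ι)).prod (Set.finite_Icc (-N) (N - n))).subset ?_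
  rintro ⟨u, m⟩ h
  refine ⟨Set.mem_univ _, ?_⟩
  by_contra hm
  apply h
  have : N < (p u m).idx ∨ N < (q u m).idx := by
    rw [hp, hq]
    simp only [Set.mem_Icc, not_and_or, not_le] at hm
    omega
  rw [LinearMap.smul_apply, nord_eq_zero B hN _ hw (by simpa using this), smul_zero]

theorem locFin_three (p : ι → ι → ℤ → Mode K ℓ) (q r : ι → ℤ → Mode K ℓ)
    (hp : ∀ u v i, (p u v i).idx = i) (hq : ∀ u i, (q u i).idx = i)
    (hr : ∀ u i, (r u i).idx = i) :
    LocFin fun s : (ι × ι) × ℤ × ℤ =>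
      nord B [p s.1.1 s.1.2 (s.2.1 + s.2.2), q s.1.2 (-s.2.1), r s.1.1 (-s.2.2)] := by
  intro w
  obtain ⟨N, hN, hw⟩ := exists_bounded w
  refine ((Set.finite_univ (α := ι × ι)).prod
    ((Set.finite_Icc (-N) (2 * N)).prod (Set.finite_Icc (-N) (2 * N)))).subset ?_
  rintro ⟨⟨u, v⟩, i, j⟩ h
  refine ⟨Set.mem_univ _, ?_⟩
  by_contra hm
  apply h
  have : N < (p u v (i + j)).idx ∨ N < (q v (-i)).idx ∨ N < (r u (-j)).idx := by
    rw [hp, hq, hr]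
    simp only [Set.mem_prod, Set.mem_Icc, not_and_or, not_le] at hm
    omega
  exact nord_eq_zero B hN _ hw (by simpa using this)

/-- `L_n = - ∑_{u,m} m :b_{n+m}^u c_{-m}^{u'}: - ∑_{u,m} m :β_{n+m}^u γ_{-m}^{u'}:`. -/
noncomputable def L (n : ℤ) : Module.End K (W K ι) :=
  - locSum (fun i : ι × ℤ => (i.2 : K) •
      nord B [.b (B i.1) (n + i.2), .c (B.coord i.1) (-i.2)])
      (locFin_two B (fun u m => .b (B u) (n + m)) (fun u m => .c (B.coord u) (-m)) n
        (fun _ _ => rfl) (fun _ _ => rfl) (fun m => (m : K)))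
  - locSum (fun i : ι × ℤ => (i.2 : K) •
      nord B [.β (B i.1) (n + i.2), .γ (B.coord i.1) (-i.2)])
      (locFin_two B (fun u m => .β (B u) (n + m)) (fun u m => .γ (B.coord u) (-m)) n
        (fun _ _ => rfl) (fun _ _ => rfl) (fun m => (m : K)))

theorem locFin_theta (p q : ι → ℤ → Mode K ℓ) (n : ℤ)
    (hp : ∀ u m, (p u m).idx = n + m) (hq : ∀ u m, (q u m).idx = -m) :
    LocFin fun i : ι × ℤ => nord B [p i.1 i.2, q i.1 i.2] := by
  simpa using locFin_two B p q n hp hq (fun _ => 1)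

/-- The action of `x_n = x ⊗ t^n` in the loop algebra:
`θ(x_n) = ∑_{v,m} :β_{n+m}^{[x,v]} γ_{-m}^{v'}: + ∑_{v,m} :b_{n+m}^{[x,v]} c_{-m}^{v'}:`. -/
noncomputable def θ (x : ℓ) (n : ℤ) : Module.End K (W K ι) :=
  locSum (fun i : ι × ℤ => nord B [.β ⁅x, B i.1⁆ (n + i.2), .γ (B.coord i.1) (-i.2)])
      (locFin_theta B (fun v m => .β ⁅x, B v⁆ (n + m)) (fun v m => .γ (B.coord v) (-m)) n
        (fun _ _ => rfl) (fun _ _ => rfl))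
  + locSum (fun i : ι × ℤ => nord B [.b ⁅x, B i.1⁆ (n + i.2), .c (B.coord i.1) (-i.2)])
      (locFin_theta B (fun v m => .b ⁅x, B v⁆ (n + m)) (fun v m => .c (B.coord v) (-m)) n
        (fun _ _ => rfl) (fun _ _ => rfl))

/-- The semi-infinite differential
`Q = ∑_{u,v;i,j} :β_{i+j}^{[u,v]} γ_{-i}^{v'} c_{-j}^{u'}:
  + 1/2 ∑_{u,v;i,j} :b_{i+j}^{[u,v]} c_{-i}^{v'} c_{-j}^{u'}:`. -/
noncomputable def Q : Module.End K (W K ι) :=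
  locSum (fun s : (ι × ι) × ℤ × ℤ =>
      nord B [.β ⁅B s.1.1, B s.1.2⁆ (s.2.1 + s.2.2), .γ (B.coord s.1.2) (-s.2.1),
        .c (B.coord s.1.1) (-s.2.2)])
      (locFin_three B (fun u v i => .β ⁅B u, B v⁆ i) (fun v i => .γ (B.coord v) i)
        (fun u i => .c (B.coord u) i) (fun _ _ _ => rfl) (fun _ _ => rfl) (fun _ _ => rfl))
  + (1 / 2 : K) • locSum (fun s : (ι × ι) × ℤ × ℤ =>
      nord B [.b ⁅B s.1.1, B s.1.2⁆ (s.2.1 + s.2.2), .c (B.coord s.1.2) (-s.2.1),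
        .c (B.coord s.1.1) (-s.2.2)])
      (locFin_three B (fun u v i => .b ⁅B u, B v⁆ i) (fun v i => .c (B.coord v) i)
        (fun u i => .c (B.coord u) i) (fun _ _ _ => rfl) (fun _ _ => rfl) (fun _ _ => rfl))

theorem locFin_mul (p q : ι → ℤ → Mode K ℓ)
    (hcomm : ∀ u m, op B (p u m) * op B (q u m) = op B (q u m) * op B (p u m))
    (hp : ∀ u m, (p u m).idx = m) (hq : ∀ u m, (q u m).idx = -m) (r : ℤ → K) :
    LocFin fun i : ι × ℤ => r i.2 • (op B (p i.1 i.2) * op B (q i.1 i.2)) := by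
  intro w
  obtain ⟨N, hN, hw⟩ := exists_bounded w
  refine ((Set.finite_univ (α := ι)).prod (Set.finite_Icc (-N) N)).subset ?_
  rintro ⟨u, m⟩ h
  refine ⟨Set.mem_univ _, ?_⟩
  by_contra hm
  apply h
  simp only [Set.mem_Icc, not_and_or, not_le] at hm
  rcases hm with hm | hm
  · rw [LinearMap.smul_apply, Module.End.mul_apply,
      op_eq_zero B hw (q u m) (by rw [hq]; omega), map_zero, smul_zero]
  · dsimp only
    rw [hcomm, LinearMap.smul_apply, Module.End.mul_apply,
      op_eq_zero B hw (p u m) (by rw [hp]; omega), map_zero, smul_zero]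

theorem op_γ_b (f : Module.Dual K ℓ) (x : ℓ) (n m : ℤ) :
    op B (.b x n) * op B (.γ f m) = op B (.γ f m) * op B (.b x n) := by
  simp only [op, Finset.sum_mul_sum, smul_mul_smul_comm]
  rw [Finset.sum_comm]
  refine Finset.sum_congr rfl fun u _ => Finset.sum_congr rfl fun v _ => ?_
  rw [mul_comm]
  congr 1
  exact LinearMap.ext fun w => (weyl_cliff_comm _ _ w).symm

theorem op_β_c (f : Module.Dual K ℓ) (x : ℓ) (n m : ℤ) :
    op B (.β x n) * op B (.c f m) = op B (.c f m) * op B (.β x n) := by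
  simp only [op, Finset.sum_mul_sum, smul_mul_smul_comm]
  rw [Finset.sum_comm]
  refine Finset.sum_congr rfl fun u _ => Finset.sum_congr rfl fun v _ => ?_
  rw [mul_comm]
  congr 1
  exact LinearMap.ext fun w => weyl_cliff_comm _ _ w

theorem locFin_h : LocFin fun i : ι × ℤ =>
    op B (.γ (B.coord i.1) (-i.2)) * op B (.b (B i.1) i.2) := by
  have := locFin_mul B (fun u m => .b (B u) m) (fun u m => .γ (B.coord u) (-m))
    (fun _ _ => op_γ_b B _ _ _ _) (fun _ _ => rfl) (fun _ _ => rfl) (fun _ => 1)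
  simpa only [one_smul, op_γ_b] using this

/-- The semi-infinite Koszul differential `h = ∑_{u,n} γ_{-n}^{u'} b_n^u`. -/
noncomputable def h : Module.End K (W K ι) :=
  locSum (fun i : ι × ℤ => op B (.γ (B.coord i.1) (-i.2)) * op B (.b (B i.1) i.2))
    (locFin_h B)

/-- The homotopy operator `k = ∑_{u,n} n β_n^u c_{-n}^{u'}`. -/
noncomputable def k : Module.End K (W K ι) :=
  locSum (fun i : ι × ℤ =>
      (i.2 : K) • (op B (.β (B i.1) i.2) * op B (.c (B.coord i.1) (-i.2))))
    (locFin_mul B (fun u m => .β (B u) m) (fun u m => .c (B.coord u) (-m))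
      (fun _ _ => op_β_c B _ _ _ _) (fun _ _ => rfl) (fun _ _ => rfl) (fun m => (m : K)))

end Operators

end VOWA

/-! The supercommutator with the odd operator `h` is a superderivation sending β to b, c to γ, and
b, γ to 0; the one with `k` sends b_n to nβ_n, γ_n to nc_n, and β, c to 0. The operators in question
are boundaries for `h` of words in β and c alone. Such words contain no dual pair of generators, so
they need no normal ordering; when the boundary is put in normal order, the constants from βγ and
from bc cancel.

Thus -L_n = {h, ∑ m β_{n+m}^u c_{-m}^{u'}}, θ(x_n) = {h, θPrim}, and 2Q = [h, QPrim] with QPrim = ∑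
β^{[u,v]} c^{v'} c^{u'} (`nord_β_γ_add_nord_b_c`, `nord_β_γ_c_sub_add_nord_b_c_c`). Since h² = 0,
the operator `h` supercommutes with all of them. For n = 0 the primitive of -L_0 is `k` itself, so
hk + kh = -L_0, and k² = 0 makes `k` commute with L_0.

The operator hk + kh multiplies a word in β, c by its total index under commutator, so it commutes
with words of total index 0. As `k` supercommutes with β and c, the super Jacobi identity shows that
`k` supercommutes with the boundary under `h` of any such word, in particular with θ(x_0) and,
summand by summand, with 2Q.

For Q² = 0 it suffices that Q commutes with QPrim: together with Qh = -hQ this gives 2Q² = Q[h,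
QPrim] = -[h, QPrim]Q = -2Q². The commutators of QPrim with the two parts of Q are multiples of ∑
β^{[[u,v],x]} c^{x'} c^{v'} c^{u'}, which vanishes by the Jacobi identity of `ℓ` (`locSum_jacobi`).
-/

namespace VOWA

/-! ### Calculus of locally finite sums of operators. -/

section LocallyFiniteSums

variable {K : Type*} [Field K] {ι I J : Type*}

/-- `S` is the sum of the family of operators `T`, of which only finitely many act nontrivially
on any given vector. -/
def HasLocSum (T : I → Module.End K (W K ι)) (S : Module.End K (W K ι)) : Prop :=
  ∀ w, {i | T i w ≠ 0}.Finite ∧ ∑ᶠ i, T i w = S w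

theorem end_smul_neg (a : K) (x : Module.End K (W K ι)) : a • (-x) = -(a • x) := smul_neg a x

theorem end_neg_smul (a : K) (x : Module.End K (W K ι)) : (-a) • x = -(a • x) := neg_smul a x

theorem end_smul_sub (a : K) (x y : Module.End K (W K ι)) : a • (x - y) = a • x - a • y :=
  smul_sub a x y

theorem end_neg_mul (x y : Module.End K (W K ι)) : -x * y = -(x * y) := neg_mul x y

theorem end_mul_neg (x y : Module.End K (W K ι)) : x * -y = -(x * y) := mul_neg x y

namespace HasLocSum

variable {T T' : I → Module.End K (W K ι)} {S S' : Module.End K (W K ι)}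

theorem unique (hS : HasLocSum T S) (hS' : HasLocSum T S') : S = S' :=
  LinearMap.ext fun w => (hS w).2.symm.trans (hS' w).2

theorem congr (hS : HasLocSum T S) (h : ∀ i, T i = T' i) : HasLocSum T' S :=
  funext h ▸ hS

theorem mul_left (A : Module.End K (W K ι)) (hS : HasLocSum T S) :
    HasLocSum (fun i => A * T i) (A * S) := fun w => by
  refine ⟨(hS w).1.subset fun i hi hT => hi ?_, ?_⟩
  · rw [Module.End.mul_apply, hT, map_zero]
  · rw [Module.End.mul_apply, ← (hS w).2]
    exact (AddMonoidHom.map_finsum (A : W K ι →+ W K ι) (hS w).1).symm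

theorem mul_right (hS : HasLocSum T S) (A : Module.End K (W K ι)) :
    HasLocSum (fun i => T i * A) (S * A) := fun w => hS (A w)

theorem add (hS : HasLocSum T S) (hS' : HasLocSum T' S') :
    HasLocSum (fun i => T i + T' i) (S + S') := fun w => by
  refine ⟨((hS w).1.union (hS' w).1).subset fun i hi => ?_, ?_⟩
  · by_contra hn
    simp only [Set.mem_union, Set.mem_ofPred_eq, not_or, not_not] at hn
    exact hi (by rw [LinearMap.add_apply, hn.1, hn.2, add_zero])
  · simp only [LinearMap.add_apply]
    rw [finsum_add_distrib (hS w).1 (hS' w).1, (hS w).2, (hS' w).2]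

theorem smul (c : K) (hS : HasLocSum T S) : HasLocSum (fun i => c • T i) (c • S) := by
  have h := hS.mul_left (algebraMap K _ c)
  simpa only [Algebra.algebraMap_eq_smul_one, smul_mul_assoc, one_mul] using h

theorem neg (hS : HasLocSum T S) : HasLocSum (fun i => - T i) (- S) := by
  have h := (hS.mul_left (-1)).congr fun i => neg_one_mul (T i)
  have e : -1 * S = -S := neg_one_mul S
  rwa [e] at h

theorem sub (hS : HasLocSum T S) (hS' : HasLocSum T' S') :
    HasLocSum (fun i => T i - T' i) (S - S') := by
  simpa only [sub_eq_add_neg] using hS.add hS'.neg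

theorem comp_equiv (hS : HasLocSum T S) (e : J ≃ I) : HasLocSum (fun j => T (e j)) S := fun w =>
  ⟨(hS w).1.preimage e.injective.injOn, (finsum_comp_equiv e).trans (hS w).2⟩

/-- If `F i` does not kill `w`, then neither does some `T (i, j)`, so `F` inherits local finiteness
from `T`. This serves to regroup double and triple sums over the loop algebra. -/
theorem fiberwise {T : I × J → Module.End K (W K ι)} {F : I → Module.End K (W K ι)} (hS : HasLocSum T S)
    (hF : ∀ i, HasLocSum (fun j => T (i, j)) (F i)) : HasLocSum F S := fun w => by
  refine ⟨((hS w).1.image Prod.fst).subset fun i hi => ?_, ?_⟩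
  · by_contra hn
    refine hi ?_
    rw [← (hF i w).2]
    refine finsum_eq_zero_of_forall_eq_zero fun j => ?_
    by_contra hj
    exact hn ⟨(i, j), hj, rfl⟩
  · rw [← (hS w).2, finsum_curry _ (hS w).1]
    exact finsum_congr fun i => (hF i w).2.symm

/-- Reduces commutation with an infinite sum to its summands: both products are sums of the same
family. -/
theorem commute (hS : HasLocSum T S) {A : Module.End K (W K ι)} (h : ∀ i, A * T i = T i * A) :
    A * S = S * A :=
  (hS.mul_left A).unique ((hS.mul_right A).congr fun i => (h i).symm)

theorem anticommute (hS : HasLocSum T S) {A : Module.End K (W K ι)} (h : ∀ i, A * T i = -(T i * A)) :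
    A * S = -(S * A) :=
  (hS.mul_left A).unique ((hS.mul_right A).neg.congr fun i => (h i).symm)

/-- The shape left by contracting a locally finite sum with one mode: the delta fixes the integer
index, and a finite sum over the basis remains. -/
theorem ite_snd [Fintype I] [DecidableEq J] (F : I → Module.End K (W K ι)) (n : J) :
    HasLocSum (fun i : I × J => if i.2 = n then F i.1 else 0) (∑ u, F u) := fun w => by
  have hfin : {i : I × J | (if i.2 = n then F i.1 else 0) w ≠ 0}.Finite := by
    refine ((Set.finite_univ (α := I)).prod (Set.finite_singleton n)).subset fun i hi => ?_
    refine ⟨Set.mem_univ _, ?_⟩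
    by_contra hn
    exact hi (by rw [if_neg (by simpa using hn), LinearMap.zero_apply])
  refine ⟨hfin, ?_⟩
  rw [finsum_curry _ hfin, finsum_eq_sum_of_fintype, LinearMap.sum_apply]
  refine Finset.sum_congr rfl fun u _ => ?_
  rw [finsum_eq_single _ n fun m hm => by simp [hm]]
  simp

end HasLocSum

end LocallyFiniteSums

/-! ### Commutation relations of the modes with arguments in `ℓ` and its dual. -/

section Relations

variable {K : Type*} [Field K] {ℓ : Type*} [LieRing ℓ] [LieAlgebra K ℓ]
  {ι : Type*} [Fintype ι] (B : Module.Basis ι K ℓ)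

omit [Fintype ι] in
theorem hasLocSum_locSum {I : Type*} {T : I → Module.End K (W K ι)} (hT : LocFin T) :
    HasLocSum T (locSum T hT) := fun w => ⟨hT w, rfl⟩

theorem sum_smul_op_b (x : ℓ) (n : ℤ) :
    ∑ u, B.coord u x • op B (.b (B u) n) = op B (.b x n) := by
  classical
  simp [op, Finsupp.single_apply, ite_smul]

theorem sum_smul_op_β (x : ℓ) (n : ℤ) :
    ∑ u, B.coord u x • op B (.β (B u) n) = op B (.β x n) := by
  classical
  simp [op, Finsupp.single_apply, ite_smul]

theorem sum_smul_op_c (f : Module.Dual K ℓ) (n : ℤ) :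
    ∑ u, f (B u) • op B (.c (B.coord u) n) = op B (.c f n) := by
  classical
  simp [op, Finsupp.single_apply, ite_smul]

theorem sum_smul_op_γ (f : Module.Dual K ℓ) (n : ℤ) :
    ∑ u, f (B u) • op B (.γ (B.coord u) n) = op B (.γ f n) := by
  classical
  simp [op, Finsupp.single_apply, ite_smul]

/-- `β_n^x` as a linear function of `x`. -/
noncomputable def opβLin (n : ℤ) : ℓ →ₗ[K] Module.End K (W K ι) where
  toFun x := op B (.β x n)
  map_add' x y := by simp [op, add_smul, Finset.sum_add_distrib]
  map_smul' a x := by simp [op, mul_smul, Finset.smul_sum]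

theorem op_β_add (x y : ℓ) (n : ℤ) : op B (.β (x + y) n) = op B (.β x n) + op B (.β y n) :=
  map_add (opβLin B n) x y

theorem op_β_neg (x : ℓ) (n : ℤ) : op B (.β (-x) n) = - op B (.β x n) :=
  map_neg (opβLin B n) x

theorem op_β_zero (n : ℤ) : op B (.β 0 n) = 0 :=
  map_zero (opβLin B n)

/-- Bilinearity of the ε-commutator, which carries the relations from basis generators over to
arbitrary arguments. -/
theorem sum_mul_sum_comm_smul {A : Type*} [Ring A] [Algebra K A] (ε : ℤ) (r s : ι → K)
    (F G : ι → A) :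
    (∑ u, r u • F u) * (∑ v, s v • G v) - ε • ((∑ v, s v • G v) * (∑ u, r u • F u))
      = ∑ u, ∑ v, (r u * s v) • (F u * G v - ε • (G v * F u)) := by
  simp only [Finset.sum_mul_sum, smul_mul_smul_comm, smul_sub, Finset.sum_sub_distrib]
  congr 1
  rw [Finset.sum_comm, Finset.smul_sum]
  refine Finset.sum_congr rfl fun u _ => ?_
  rw [Finset.smul_sum]
  refine Finset.sum_congr rfl fun v _ => ?_
  rw [smul_comm, mul_comm]

theorem sum_pairing {A : Type*} [Ring A] [Algebra K A] (f : Module.Dual K ℓ) (x : ℓ) (n m : ℤ) :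
    ∑ u, ∑ v, (f (B u) * B.repr x v) • algebraMap K A (pairing K ι u n v m)
      = (if n + m = 0 then f x else 0) • (1 : A) := by
  classical
  have hf : f x = ∑ u, f (B u) * B.repr x u := by
    conv_lhs => rw [← B.sum_repr x, map_sum]
    simp only [map_smul, smul_eq_mul, mul_comm]
  by_cases hnm : n + m = 0
  · simp [pairing, hnm, hf, Finset.sum_smul]
  · simp [pairing, hnm]

theorem op_c_mul_op_b (f : Module.Dual K ℓ) (x : ℓ) (n m : ℤ) :
    op B (.c f n) * op B (.b x m)
      = - (op B (.b x m) * op B (.c f n)) + (if n + m = 0 then f x else 0) • 1 := by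
  have h := sum_mul_sum_comm_smul (-1) (fun u => f (B u)) (fun v => B.repr x v)
    (fun u => cliff K ι (gen K ι (-1) (.cov u n))) (fun v => cliff K ι (gen K ι (-1) (.vec v m)))
  have e : ∀ u v, cliff K ι (gen K ι (-1) (.cov u n)) * cliff K ι (gen K ι (-1) (.vec v m))
      - (-1 : ℤ) • (cliff K ι (gen K ι (-1) (.vec v m)) * cliff K ι (gen K ι (-1) (.cov u n)))
      = algebraMap K _ (pairing K ι u n v m) := fun u v => by
    rw [← map_mul, gen_cov_vec, map_add, AlgHom.commutes]
    simp
  simp only [e, sum_pairing] at h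
  rw [← h]
  simp only [op]
  simp

theorem op_γ_mul_op_β (f : Module.Dual K ℓ) (x : ℓ) (n m : ℤ) :
    op B (.γ f n) * op B (.β x m)
      = op B (.β x m) * op B (.γ f n) + (if n + m = 0 then f x else 0) • 1 := by
  have h := sum_mul_sum_comm_smul 1 (fun u => f (B u)) (fun v => B.repr x v)
    (fun u => weyl K ι (gen K ι 1 (.cov u n))) (fun v => weyl K ι (gen K ι 1 (.vec v m)))
  have e : ∀ u v, weyl K ι (gen K ι 1 (.cov u n)) * weyl K ι (gen K ι 1 (.vec v m))
      - (1 : ℤ) • (weyl K ι (gen K ι 1 (.vec v m)) * weyl K ι (gen K ι 1 (.cov u n)))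
      = algebraMap K _ (pairing K ι u n v m) := fun u v => by
    rw [← map_mul, gen_cov_vec, map_add, AlgHom.commutes]
    simp
  simp only [e, sum_pairing] at h
  rw [← h]
  simp only [op]
  simp

theorem op_b_mul_op_b (x y : ℓ) (n m : ℤ) :
    op B (.b x n) * op B (.b y m) = - (op B (.b y m) * op B (.b x n)) := by
  have h := sum_mul_sum_comm_smul (-1) (fun v => B.repr x v) (fun v => B.repr y v)
    (fun u => cliff K ι (gen K ι (-1) (.vec u n))) (fun v => cliff K ι (gen K ι (-1) (.vec v m)))
  simp only [← map_mul, gen_vec_vec (-1) _ _ n m, map_zsmul] at h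
  simpa [op, ← eq_neg_iff_add_eq_zero] using h

theorem op_c_mul_op_c (f g : Module.Dual K ℓ) (n m : ℤ) :
    op B (.c f n) * op B (.c g m) = - (op B (.c g m) * op B (.c f n)) := by
  have h := sum_mul_sum_comm_smul (-1) (fun v => f (B v)) (fun v => g (B v))
    (fun u => cliff K ι (gen K ι (-1) (.cov u n))) (fun v => cliff K ι (gen K ι (-1) (.cov v m)))
  simp only [← map_mul, gen_cov_cov (-1) _ _ n m, map_zsmul] at h
  simpa [op, ← eq_neg_iff_add_eq_zero] using h

theorem op_β_mul_op_β (x y : ℓ) (n m : ℤ) :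
    op B (.β x n) * op B (.β y m) = op B (.β y m) * op B (.β x n) := by
  have h := sum_mul_sum_comm_smul 1 (fun v => B.repr x v) (fun v => B.repr y v)
    (fun u => weyl K ι (gen K ι 1 (.vec u n))) (fun v => weyl K ι (gen K ι 1 (.vec v m)))
  simp only [← map_mul, gen_vec_vec 1 _ _ n m, map_zsmul] at h
  simpa [op, sub_eq_zero] using h

theorem op_γ_mul_op_γ (f g : Module.Dual K ℓ) (n m : ℤ) :
    op B (.γ f n) * op B (.γ g m) = op B (.γ g m) * op B (.γ f n) := by
  have h := sum_mul_sum_comm_smul 1 (fun v => f (B v)) (fun v => g (B v))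
    (fun u => weyl K ι (gen K ι 1 (.cov u n))) (fun v => weyl K ι (gen K ι 1 (.cov v m)))
  simp only [← map_mul, gen_cov_cov 1 _ _ n m, map_zsmul] at h
  simpa [op, sub_eq_zero] using h

theorem op_weyl_cliff_comm (r s : ι → K) (x : ι → OscAlg K ι 1) (y : ι → OscAlg K ι (-1)) :
    (∑ u, r u • weyl K ι (x u)) * (∑ u, s u • cliff K ι (y u))
      = (∑ u, s u • cliff K ι (y u)) * (∑ u, r u • weyl K ι (x u)) := by
  have h := sum_mul_sum_comm_smul 1 r s (fun u => weyl K ι (x u)) (fun u => cliff K ι (y u))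
  have e : ∀ u v, weyl K ι (x u) * cliff K ι (y v) = cliff K ι (y v) * weyl K ι (x u) :=
    fun u v => LinearMap.ext fun w => weyl_cliff_comm _ _ w
  simpa [e, sub_eq_zero] using h

theorem op_β_mul_op_b (x y : ℓ) (n m : ℤ) :
    op B (.β x n) * op B (.b y m) = op B (.b y m) * op B (.β x n) :=
  op_weyl_cliff_comm _ _ _ _

theorem op_γ_mul_op_c (f g : Module.Dual K ℓ) (n m : ℤ) :
    op B (.γ f n) * op B (.c g m) = op B (.c g m) * op B (.γ f n) :=
  op_weyl_cliff_comm _ _ _ _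

end Relations

/-! ### Supercommutators of `h` and `k` with the modes and with themselves. -/

section KoszulOperators

variable {K : Type*} [Field K] {ℓ : Type*} [LieRing ℓ] [LieAlgebra K ℓ]
  {ι : Type*} [Fintype ι] (B : Module.Basis ι K ℓ)

theorem hasLocSum_h : HasLocSum (fun i : ι × ℤ =>
    op B (.γ (B.coord i.1) (-i.2)) * op B (.b (B i.1) i.2)) (h B) :=
  hasLocSum_locSum _

theorem hasLocSum_k : HasLocSum (fun i : ι × ℤ =>
    (i.2 : K) • (op B (.β (B i.1) i.2) * op B (.c (B.coord i.1) (-i.2)))) (k B) :=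
  hasLocSum_locSum _

theorem h_mul_γ (f : Module.Dual K ℓ) (n : ℤ) : h B * op B (.γ f n) = op B (.γ f n) * h B := by
  refine ((hasLocSum_h B).commute fun i => ?_).symm
  linear_combination (norm := noncomm_ring [smul_mul_assoc, mul_smul_comm])
    op_γ_mul_op_γ B f (B.coord i.1) n (-i.2) * op B (.b (B i.1) i.2)
      - op B (.γ (B.coord i.1) (-i.2)) * op_γ_b B f (B i.1) i.2 n

theorem h_mul_b (x : ℓ) (n : ℤ) : h B * op B (.b x n) = -(op B (.b x n) * h B) := by
  refine neg_eq_iff_eq_neg.mp ((hasLocSum_h B).anticommute fun i => ?_).symm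
  linear_combination (norm := noncomm_ring [smul_mul_assoc, mul_smul_comm])
    op_γ_b B (B.coord i.1) x n (-i.2) * op B (.b (B i.1) i.2)
      + op B (.γ (B.coord i.1) (-i.2)) * op_b_mul_op_b B x (B i.1) n i.2

/-- Only γ in the summand γ_{-m} b_m contracts with β_n, which forces m = n; summing over the basis
reassembles b_n^x. The lemmas `h_mul_c`, `k_mul_b` and `k_mul_γ` follow the same pattern. -/
theorem h_mul_β (x : ℓ) (n : ℤ) :
    h B * op B (.β x n) = op B (.β x n) * h B + op B (.b x n) := by
  have h1 := ((hasLocSum_h B).mul_right (op B (.β x n))).sub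
    ((hasLocSum_h B).mul_left (op B (.β x n)))
  have h2 := HasLocSum.ite_snd (fun u => B.coord u x • op B (.b (B u) n)) n
  rw [sum_smul_op_b] at h2
  refine eq_add_of_sub_eq' (h1.unique (h2.congr fun i => ?_))
  have e : (if -i.2 + n = 0 then B.coord i.1 x else 0) • op B (.b (B i.1) i.2)
      = if i.2 = n then B.coord i.1 x • op B (.b (B i.1) n) else 0 := by
    by_cases hi : i.2 = n
    · simp [hi]
    · rw [if_neg hi, if_neg (by omega), zero_smul]
  rw [← e]
  have h3 := op_γ_mul_op_β B (B.coord i.1) x (-i.2) n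
  linear_combination (norm := noncomm_ring [smul_mul_assoc, mul_smul_comm])
    -(h3 * op B (.b (B i.1) i.2))
    + op B (.γ (B.coord i.1) (-i.2)) * op_β_mul_op_b B x (B i.1) n i.2

theorem h_mul_c (f : Module.Dual K ℓ) (n : ℤ) :
    h B * op B (.c f n) = -(op B (.c f n) * h B) + op B (.γ f n) := by
  have h1 := ((hasLocSum_h B).mul_right (op B (.c f n))).add
    ((hasLocSum_h B).mul_left (op B (.c f n)))
  have h2 := HasLocSum.ite_snd (fun u => f (B u) • op B (.γ (B.coord u) n)) (-n)
  rw [sum_smul_op_γ] at h2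
  refine eq_neg_add_of_add_eq ((add_comm _ _).trans (h1.unique (h2.congr fun i => ?_)))
  have e : (if n + i.2 = 0 then f (B i.1) else 0) • op B (.γ (B.coord i.1) (-i.2))
      = if i.2 = -n then f (B i.1) • op B (.γ (B.coord i.1) n) else 0 := by
    by_cases hi : i.2 = -n
    · simp [hi]
    · rw [if_neg hi, if_neg (by omega), zero_smul]
  rw [← e]
  have h3 := op_c_mul_op_b B f (B i.1) n i.2
  linear_combination (norm := noncomm_ring [smul_mul_assoc, mul_smul_comm])
    -(op B (.γ (B.coord i.1) (-i.2)) * h3)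
    + op_γ_mul_op_c B (B.coord i.1) f (-i.2) n * op B (.b (B i.1) i.2)

theorem k_mul_β (x : ℓ) (n : ℤ) : k B * op B (.β x n) = op B (.β x n) * k B := by
  refine ((hasLocSum_k B).commute fun i => ?_).symm
  rw [mul_smul_comm, smul_mul_assoc]
  congr 1
  linear_combination (norm := noncomm_ring [smul_mul_assoc, mul_smul_comm])
    op_β_mul_op_β B x (B i.1) n i.2 * op B (.c (B.coord i.1) (-i.2))
      + op B (.β (B i.1) i.2) * op_β_c B (B.coord i.1) x n (-i.2)

theorem k_mul_c (f : Module.Dual K ℓ) (n : ℤ) :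
    k B * op B (.c f n) = -(op B (.c f n) * k B) := by
  refine neg_eq_iff_eq_neg.mp ((hasLocSum_k B).anticommute fun i => ?_).symm
  rw [mul_smul_comm, smul_mul_assoc]
  rw [← end_smul_neg]
  congr 1
  linear_combination (norm := noncomm_ring [smul_mul_assoc, mul_smul_comm])
    op B (.β (B i.1) i.2) * op_c_mul_op_c B f (B.coord i.1) n (-i.2)
      - op_β_c B f (B i.1) i.2 n * op B (.c (B.coord i.1) (-i.2))

theorem k_mul_b (x : ℓ) (n : ℤ) :
    k B * op B (.b x n) = -(op B (.b x n) * k B) + (n : K) • op B (.β x n) := by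
  have h1 := ((hasLocSum_k B).mul_right (op B (.b x n))).add
    ((hasLocSum_k B).mul_left (op B (.b x n)))
  have h2 := HasLocSum.ite_snd (fun u => (n : K) • B.coord u x • op B (.β (B u) n)) n
  rw [← Finset.smul_sum, sum_smul_op_β] at h2
  refine eq_neg_add_of_add_eq ((add_comm _ _).trans (h1.unique (h2.congr fun i => ?_)))
  have e : (i.2 : K) • (if -i.2 + n = 0 then B.coord i.1 x else 0) • op B (.β (B i.1) i.2)
      = if i.2 = n then (n : K) • B.coord i.1 x • op B (.β (B i.1) n) else 0 := by
    by_cases hi : i.2 = n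
    · simp [hi]
    · rw [if_neg hi, if_neg (by omega), zero_smul, smul_zero]
  rw [← e, smul_mul_assoc, mul_smul_comm, ← smul_add]
  congr 1
  have h3 := op_c_mul_op_b B (B.coord i.1) x (-i.2) n
  linear_combination (norm := noncomm_ring [smul_mul_assoc, mul_smul_comm])
    -(op B (.β (B i.1) i.2) * h3)
    + op_β_mul_op_b B (B i.1) x i.2 n * op B (.c (B.coord i.1) (-i.2))

theorem k_mul_γ (f : Module.Dual K ℓ) (n : ℤ) :
    k B * op B (.γ f n) = op B (.γ f n) * k B + (n : K) • op B (.c f n) := by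
  have h1 := ((hasLocSum_k B).mul_right (op B (.γ f n))).sub
    ((hasLocSum_k B).mul_left (op B (.γ f n)))
  have h2 := HasLocSum.ite_snd (fun u => (n : K) • f (B u) • op B (.c (B.coord u) n)) (-n)
  rw [← Finset.smul_sum, sum_smul_op_c] at h2
  refine eq_add_of_sub_eq' (h1.unique (h2.congr fun i => ?_))
  -- The commutator is taken with γ on the right, whence the minus sign; the surviving index is m =
  -- -n, so the coefficient -m equals n.
  have e : -((i.2 : K) • (if n + i.2 = 0 then f (B i.1) else 0) • op B (.c (B.coord i.1) (-i.2)))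
      = if i.2 = -n then (n : K) • f (B i.1) • op B (.c (B.coord i.1) n) else 0 := by
    by_cases hi : i.2 = -n
    · simp [hi, end_neg_smul]
    · rw [if_neg hi, if_neg (by omega), zero_smul, smul_zero, neg_zero]
  rw [← e, smul_mul_assoc, mul_smul_comm]
  rw [← end_smul_sub, ← end_smul_neg]
  congr 1
  have h3 := op_γ_mul_op_β B f (B i.1) n i.2
  linear_combination (norm := noncomm_ring [smul_mul_assoc, mul_smul_comm])
    h3 * op B (.c (B.coord i.1) (-i.2))
    + op B (.β (B i.1) i.2) * op_γ_mul_op_c B f (B.coord i.1) n (-i.2)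

variable [CharZero K]

theorem eq_zero_of_eq_neg_self {V : Type*} [AddCommGroup V] [Module K V] {v : V} (hv : v = -v) :
    v = 0 := by
  have : (2 : K) • v = 0 := by rw [two_smul]; exact add_eq_zero_iff_eq_neg.mpr hv
  exact (smul_eq_zero.mp this).resolve_left two_ne_zero

/-- Each summand γb of `h` anticommutes with `h`, hence h² = -h². -/
theorem h_mul_h : h B * h B = 0 := by
  refine eq_zero_of_eq_neg_self (K := K) ((hasLocSum_h B).anticommute fun i => ?_)
  linear_combination (norm := noncomm_ring [smul_mul_assoc, mul_smul_comm])
    h_mul_γ B (B.coord i.1) (-i.2) * op B (.b (B i.1) i.2)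
      + op B (.γ (B.coord i.1) (-i.2)) * h_mul_b B (B i.1) i.2

theorem k_mul_k : k B * k B = 0 := by
  refine eq_zero_of_eq_neg_self (K := K) ((hasLocSum_k B).anticommute fun i => ?_)
  rw [mul_smul_comm, smul_mul_assoc]
  rw [← end_smul_neg]
  congr 1
  linear_combination (norm := noncomm_ring [smul_mul_assoc, mul_smul_comm])
    k_mul_β B (B i.1) i.2 * op B (.c (B.coord i.1) (-i.2))
      + op B (.β (B i.1) i.2) * k_mul_c B (B.coord i.1) (-i.2)

omit [CharZero K]

/-- The anticommutator of `h` and `k`, up to sign the energy operator. -/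
noncomputable def hk : Module.End K (W K ι) := h B * k B + k B * h B

/-- Super Jacobi: [{h,k}, β_n] = {k, [h, β_n]} + {h, [k, β_n]} = {k, b_n} + 0. Only β and c are
needed, since the primitives are words in these. -/
theorem hk_mul_β (x : ℓ) (n : ℤ) :
    hk B * op B (.β x n) = op B (.β x n) * hk B + (n : K) • op B (.β x n) := by
  linear_combination (norm := (simp only [hk]; noncomm_ring [smul_mul_assoc, mul_smul_comm]))
    h B * k_mul_β B x n + h_mul_β B x n * k B + k B * h_mul_β B x n + k_mul_β B x n * h B
      + k_mul_b B x n

theorem hk_mul_c (f : Module.Dual K ℓ) (n : ℤ) :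
    hk B * op B (.c f n) = op B (.c f n) * hk B + (n : K) • op B (.c f n) := by
  linear_combination (norm := (simp only [hk]; noncomm_ring [smul_mul_assoc, mul_smul_comm]))
    h B * k_mul_c B f n - h_mul_c B f n * k B + k B * h_mul_c B f n - k_mul_c B f n * h B
      + k_mul_γ B f n

end KoszulOperators

/-! ### Normal ordered words and their primitives under `h`. -/

section NormalOrdering

variable {K : Type*} [Field K] {ℓ : Type*} [LieRing ℓ] [LieAlgebra K ℓ]
  {ι : Type*} [Fintype ι] (B : Module.Basis ι K ℓ)

theorem nord_β_cons (x : ℓ) (p : ℤ) (l : List (Mode K ℓ)) :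
    nord B (.β x p :: l) = if p ≤ -1 then op B (.β x p) * nord B l else nord B l * op B (.β x p) := by
  simp [nord, Mode.IsCreation, Mode.IsOdd]

theorem nord_c (f : Module.Dual K ℓ) (p : ℤ) : nord B [.c f p] = op B (.c f p) := by
  simp [nord]

theorem nord_γ (f : Module.Dual K ℓ) (p : ℤ) : nord B [.γ f p] = op B (.γ f p) := by
  simp [nord]

theorem nord_b_c (x : ℓ) (f : Module.Dual K ℓ) (p q : ℤ) :
    nord B [.b x p, .c f q] = if p ≤ -1 then op B (.b x p) * op B (.c f q)
      else -(op B (.c f q) * op B (.b x p)) := by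
  rw [nord, nord_c]
  simp [Mode.IsCreation, Mode.IsOdd]

theorem nord_c_c (f g : Module.Dual K ℓ) (p q : ℤ) :
    nord B [.c f p, .c g q] = op B (.c f p) * op B (.c g q) := by
  rw [nord, nord_c, op_c_mul_op_c B f g]
  simp [Mode.IsCreation, Mode.IsOdd]

theorem nord_γ_c (f g : Module.Dual K ℓ) (p q : ℤ) :
    nord B [.γ f p, .c g q] = op B (.γ f p) * op B (.c g q) := by
  rw [nord, nord_c, op_γ_mul_op_c B f g]
  simp [Mode.IsCreation, Mode.IsOdd]

omit [Fintype ι] in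
theorem not_odd_countP_c_c (f g : Module.Dual K ℓ) (p q : ℤ) :
    ¬ Odd (List.countP Mode.IsOdd [Mode.c f p, Mode.c g q]) := by
  change ¬ Odd 2
  decide

theorem nord_c_c_c (f g e : Module.Dual K ℓ) (p q r : ℤ) :
    nord B [.c f p, .c g q, .c e r] = op B (.c f p) * (op B (.c g q) * op B (.c e r)) := by
  have h : op B (.c g q) * op B (.c e r) * op B (.c f p)
      = op B (.c f p) * (op B (.c g q) * op B (.c e r)) := by
    linear_combination (norm := noncomm_ring [smul_mul_assoc, mul_smul_comm])
      op B (.c g q) * op_c_mul_op_c B e f r p - op_c_mul_op_c B g f q p * op B (.c e r)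
  rw [nord, nord_c_c]
  simp [Mode.IsCreation, h, not_odd_countP_c_c]

theorem nord_b_c_c (x : ℓ) (f g : Module.Dual K ℓ) (p q r : ℤ) :
    nord B [.b x p, .c f q, .c g r] =
      if p ≤ -1 then op B (.b x p) * (op B (.c f q) * op B (.c g r))
      else op B (.c f q) * op B (.c g r) * op B (.b x p) := by
  rw [nord, nord_c_c]
  simp [Mode.IsCreation, not_odd_countP_c_c]

theorem op_β_mul_c_c (x : ℓ) (f g : Module.Dual K ℓ) (p q r : ℤ) :
    op B (.c f q) * op B (.c g r) * op B (.β x p)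
      = op B (.β x p) * (op B (.c f q) * op B (.c g r)) := by
  linear_combination (norm := noncomm_ring [smul_mul_assoc, mul_smul_comm])
    -(op B (.c f q) * op_β_c B g x p r) - op_β_c B f x p q * op B (.c g r)

/-- Modes β and c never contract with each other, so normal ordering has no effect on words in them.
Writing the primitives with `nord` nevertheless gives their local finiteness through `nord_eq_zero`.
-/
theorem nord_β_c (x : ℓ) (f : Module.Dual K ℓ) (p q : ℤ) :
    nord B [.β x p, .c f q] = op B (.β x p) * op B (.c f q) := by
  rw [nord_β_cons, nord_c, op_β_c, ite_self]

theorem nord_β_c_c (x : ℓ) (f g : Module.Dual K ℓ) (p q r : ℤ) :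
    nord B [.β x p, .c f q, .c g r]
      = op B (.β x p) * (op B (.c f q) * op B (.c g r)) := by
  rw [nord_β_cons, nord_c_c, op_β_mul_c_c, ite_self]

theorem nord_β_c_c_c (x : ℓ) (f g e : Module.Dual K ℓ) (p q r s : ℤ) :
    nord B [.β x p, .c f q, .c g r, .c e s]
      = op B (.β x p) * (op B (.c f q) * (op B (.c g r) * op B (.c e s))) := by
  rw [nord_β_cons, nord_c_c_c, mul_assoc (op B (.c f q)) _ (op B (.β x p)), op_β_mul_c_c,
    ← mul_assoc _ (op B (.β x p)), ← op_β_c, mul_assoc, ite_self]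

/-- The quadratic operators `:βγ: + :bc:` are exact for `h`. -/
theorem nord_β_γ_add_nord_b_c (x : ℓ) (f : Module.Dual K ℓ) (p q : ℤ) :
    nord B [.β x p, .γ f q] + nord B [.b x p, .c f q]
      = h B * (op B (.β x p) * op B (.c f q)) + op B (.β x p) * op B (.c f q) * h B := by
  -- The identity without normal ordering is the Leibniz rule for `h`.
  have h0 : op B (.β x p) * op B (.γ f q) + op B (.b x p) * op B (.c f q)
      = h B * (op B (.β x p) * op B (.c f q)) + op B (.β x p) * op B (.c f q) * h B := by
    linear_combination (norm := noncomm_ring [smul_mul_assoc, mul_smul_comm])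
      -(h_mul_β B x p * op B (.c f q)) - op B (.β x p) * h_mul_c B f q
  rw [← h0, nord_β_cons, nord_b_c, nord_γ]
  split_ifs
  · rfl
  -- For p ≥ 0 both words are reordered. The Weyl contraction gives +f(x)δ and the Clifford
  -- contraction -f(x)δ, so the constants cancel.
  · linear_combination (norm := noncomm_ring [smul_mul_assoc, mul_smul_comm])
      op_γ_mul_op_β B f x q p - op_c_mul_op_b B f x q p

/-- The cubic operators of `Q`, antisymmetrized, are exact for `h`. -/
theorem nord_β_γ_c_sub_add_nord_b_c_c (x : ℓ) (f g : Module.Dual K ℓ) (p q r : ℤ) :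
    nord B [.β x p, .γ f q, .c g r] - nord B [.β x p, .γ g r, .c f q]
        + nord B [.b x p, .c f q, .c g r]
      = h B * (op B (.β x p) * (op B (.c f q) * op B (.c g r)))
        - op B (.β x p) * (op B (.c f q) * op B (.c g r)) * h B := by
  have h0 : op B (.β x p) * (op B (.γ f q) * op B (.c g r))
        - op B (.β x p) * (op B (.γ g r) * op B (.c f q))
        + op B (.b x p) * (op B (.c f q) * op B (.c g r))
      = h B * (op B (.β x p) * (op B (.c f q) * op B (.c g r)))
        - op B (.β x p) * (op B (.c f q) * op B (.c g r)) * h B := by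
    linear_combination (norm := noncomm_ring [smul_mul_assoc, mul_smul_comm])
      -(h_mul_β B x p * op B (.c f q) * op B (.c g r))
      - op B (.β x p) * h_mul_c B f q * op B (.c g r)
      + op B (.β x p) * op B (.c f q) * h_mul_c B g r
      - op B (.β x p) * op_γ_mul_op_c B g f r q
  rw [← h0, nord_β_cons, nord_β_cons, nord_b_c_c, nord_γ_c, nord_γ_c]
  split_ifs
  · rfl
  -- The same cancellation, once with c^g and once with c^f as the remaining factor.
  · linear_combination (norm := noncomm_ring [smul_mul_assoc, mul_smul_comm])
      op_γ_mul_op_β B f x q p * op B (.c g r) - op_γ_mul_op_β B g x r p * op B (.c f q)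
      - op B (.γ f q) * op_β_c B g x p r + op B (.γ g r) * op_β_c B f x p q
      + op B (.c f q) * op_c_mul_op_b B g x r p - op_c_mul_op_b B f x q p * op B (.c g r)

end NormalOrdering

/-! ### The operators L_n and θ(x_n) as boundaries under `h`. -/

section Quadratic

variable {K : Type*} [Field K] {ℓ : Type*} [LieRing ℓ] [LieAlgebra K ℓ]
  {ι : Type*} [Fintype ι] (B : Module.Basis ι K ℓ)

theorem hasLocSum_neg_L (n : ℤ) : HasLocSum (fun i : ι × ℤ => (i.2 : K) •
    (h B * (op B (.β (B i.1) (n + i.2)) * op B (.c (B.coord i.1) (-i.2)))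
      + op B (.β (B i.1) (n + i.2)) * op B (.c (B.coord i.1) (-i.2)) * h B)) (- L B n) := by
  have h1 := (hasLocSum_locSum (locFin_two B (fun u m => .β (B u) (n + m))
      (fun u m => .γ (B.coord u) (-m)) n (fun _ _ => rfl) (fun _ _ => rfl) (fun m => (m : K)))).add
    (hasLocSum_locSum (locFin_two B (fun u m => .b (B u) (n + m)) (fun u m => .c (B.coord u) (-m)) n
        (fun _ _ => rfl) (fun _ _ => rfl) (fun m => (m : K))))
  have e : ∀ x y : Module.End K (W K ι), x + y = -(-y - x) := fun x y => by abel
  rw [e] at h1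
  refine HasLocSum.congr h1 fun i => ?_
  rw [← nord_β_γ_add_nord_b_c, smul_add]

theorem hasLocSum_θ (x : ℓ) (n : ℤ) : HasLocSum (fun i : ι × ℤ =>
    h B * (op B (.β ⁅x, B i.1⁆ (n + i.2)) * op B (.c (B.coord i.1) (-i.2)))
      + op B (.β ⁅x, B i.1⁆ (n + i.2)) * op B (.c (B.coord i.1) (-i.2)) * h B) (θ B x n) := by
  have h1 := (hasLocSum_locSum (locFin_theta B (fun v m => .β ⁅x, B v⁆ (n + m))
      (fun v m => .γ (B.coord v) (-m)) n (fun _ _ => rfl) (fun _ _ => rfl))).add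
    (hasLocSum_locSum (locFin_theta B (fun v m => .b ⁅x, B v⁆ (n + m))
      (fun v m => .c (B.coord v) (-m)) n (fun _ _ => rfl) (fun _ _ => rfl)))
  refine HasLocSum.congr h1 fun i => ?_
  rw [← nord_β_γ_add_nord_b_c]

/-- For n = 0 the primitive of -L_n is `k`, term by term. -/
theorem h_mul_k_add_k_mul_h : h B * k B + k B * h B = - L B 0 := by
  refine HasLocSum.unique (((hasLocSum_k B).mul_left (h B)).add ((hasLocSum_k B).mul_right (h B)))
    ((hasLocSum_neg_L B 0).congr fun i => ?_)
  rw [zero_add, mul_smul_comm, smul_mul_assoc, smul_add]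

variable [CharZero K]

theorem h_mul_L (n : ℤ) : h B * L B n = L B n * h B := by
  have h1 := (hasLocSum_neg_L B n).commute (A := h B) fun i => by
    rw [mul_smul_comm, smul_mul_assoc]
    congr 1
    linear_combination (norm := noncomm_ring [smul_mul_assoc, mul_smul_comm])
      h_mul_h B * op B (.β (B i.1) (n + i.2)) * op B (.c (B.coord i.1) (-i.2))
      - op B (.β (B i.1) (n + i.2)) * op B (.c (B.coord i.1) (-i.2)) * h_mul_h B
  linear_combination (norm := noncomm_ring [smul_mul_assoc, mul_smul_comm]) -h1

/-- Both k(hk + kh) and (hk + kh)k equal khk because k² = 0. -/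
theorem k_mul_L_zero : k B * L B 0 = L B 0 * k B := by
  linear_combination (norm := noncomm_ring [smul_mul_assoc, mul_smul_comm])
    k B * h_mul_k_add_k_mul_h B - h_mul_k_add_k_mul_h B * k B
    + h B * k_mul_k B - k_mul_k B * h B

theorem h_mul_θ (x : ℓ) (n : ℤ) : h B * θ B x n = θ B x n * h B := by
  refine (hasLocSum_θ B x n).commute fun i => ?_
  linear_combination (norm := noncomm_ring [smul_mul_assoc, mul_smul_comm])
    h_mul_h B * op B (.β ⁅x, B i.1⁆ (n + i.2)) * op B (.c (B.coord i.1) (-i.2))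
    - op B (.β ⁅x, B i.1⁆ (n + i.2)) * op B (.c (B.coord i.1) (-i.2)) * h_mul_h B

omit [CharZero K] in
theorem hk_mul_β_c (x : ℓ) (f : Module.Dual K ℓ) (p q : ℤ) (hpq : p + q = 0) :
    hk B * (op B (.β x p) * op B (.c f q)) = op B (.β x p) * op B (.c f q) * hk B := by
  obtain rfl : q = -p := by omega
  have h1 := hk_mul_β B x p
  have h2 := hk_mul_c B f (-p)
  rw [Int.cast_neg, end_neg_smul] at h2
  linear_combination (norm := noncomm_ring [smul_mul_assoc, mul_smul_comm])
    h1 * op B (.c f (-p)) + op B (.β x p) * h2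

omit [CharZero K] in
theorem k_mul_θ_zero (x : ℓ) : k B * θ B x 0 = θ B x 0 * k B := by
  refine (hasLocSum_θ B x 0).commute fun i => ?_
  have h1 := hk_mul_β_c B ⁅x, B i.1⁆ (B.coord i.1) (0 + i.2) (-i.2) (by omega)
  have h2 := k_mul_β B ⁅x, B i.1⁆ (0 + i.2)
  have h3 := k_mul_c B (B.coord i.1) (-i.2)
  have h4 : k B * (op B (.β ⁅x, B i.1⁆ (0 + i.2)) * op B (.c (B.coord i.1) (-i.2)))
      = -(op B (.β ⁅x, B i.1⁆ (0 + i.2)) * op B (.c (B.coord i.1) (-i.2)) * k B) := by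
    linear_combination (norm := noncomm_ring [smul_mul_assoc, mul_smul_comm])
      h2 * op B (.c (B.coord i.1) (-i.2)) + op B (.β ⁅x, B i.1⁆ (0 + i.2)) * h3
  simp only [hk] at h1
  -- With P the word βc and kP = -Pk, the commutator of `k` with hP + Ph equals [hk + kh, P], which
  -- is zero as P has total index 0.
  linear_combination (norm := noncomm_ring [smul_mul_assoc, mul_smul_comm])
    h1 - h B * h4 + h4 * h B

end Quadratic

/-! ### The primitive of 2Q, and the relations of Q with `h` and `k`. -/

section Primitives

variable {K : Type*} [Field K] {ℓ : Type*} [LieRing ℓ] [LieAlgebra K ℓ]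
  {ι : Type*} [Fintype ι] (B : Module.Basis ι K ℓ)

/-- `∑_{v,m} β_{n+m}^{[x,v]} c_{-m}^{v'}`, a primitive of `θ(x_n)` with respect to `h`. -/
noncomputable def θPrim (x : ℓ) (n : ℤ) : Module.End K (W K ι) :=
  locSum (fun i : ι × ℤ => nord B [.β ⁅x, B i.1⁆ (n + i.2), .c (B.coord i.1) (-i.2)])
    (locFin_theta B (fun v m => .β ⁅x, B v⁆ (n + m)) (fun v m => .c (B.coord v) (-m)) n
      (fun _ _ => rfl) (fun _ _ => rfl))

/-- `∑_{u,v;i,j} β_{i+j}^{[u,v]} c_{-i}^{v'} c_{-j}^{u'}`, a primitive of `2 Q` with respect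
to `h`. -/
noncomputable def QPrim : Module.End K (W K ι) :=
  locSum (fun s : (ι × ι) × ℤ × ℤ =>
      nord B [.β ⁅B s.1.1, B s.1.2⁆ (s.2.1 + s.2.2), .c (B.coord s.1.2) (-s.2.1),
        .c (B.coord s.1.1) (-s.2.2)])
    (locFin_three B (fun u v i => .β ⁅B u, B v⁆ i) (fun v i => .c (B.coord v) i)
      (fun u i => .c (B.coord u) i) (fun _ _ _ => rfl) (fun _ _ => rfl) (fun _ _ => rfl))

/-- The part `∑ :β γ c:` of `Q`. -/
noncomputable def Qβγc : Module.End K (W K ι) :=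
  locSum (fun s : (ι × ι) × ℤ × ℤ =>
      nord B [.β ⁅B s.1.1, B s.1.2⁆ (s.2.1 + s.2.2), .γ (B.coord s.1.2) (-s.2.1),
        .c (B.coord s.1.1) (-s.2.2)])
    (locFin_three B (fun u v i => .β ⁅B u, B v⁆ i) (fun v i => .γ (B.coord v) i)
      (fun u i => .c (B.coord u) i) (fun _ _ _ => rfl) (fun _ _ => rfl) (fun _ _ => rfl))

/-- The part `∑ :b c c:` of `2 Q`. -/
noncomputable def Qbcc : Module.End K (W K ι) :=
  locSum (fun s : (ι × ι) × ℤ × ℤ =>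
      nord B [.b ⁅B s.1.1, B s.1.2⁆ (s.2.1 + s.2.2), .c (B.coord s.1.2) (-s.2.1),
        .c (B.coord s.1.1) (-s.2.2)])
    (locFin_three B (fun u v i => .b ⁅B u, B v⁆ i) (fun v i => .c (B.coord v) i)
      (fun u i => .c (B.coord u) i) (fun _ _ _ => rfl) (fun _ _ => rfl) (fun _ _ => rfl))

theorem Q_eq : Q B = Qβγc B + (1 / 2 : K) • Qbcc B := rfl

theorem two_smul_Q [CharZero K] : (2 : K) • Q B = Qβγc B + Qβγc B + Qbcc B := by
  rw [Q_eq, smul_add, smul_smul, mul_one_div_cancel two_ne_zero, one_smul, two_smul]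

theorem hasLocSum_θPrim (x : ℓ) (n : ℤ) : HasLocSum (fun i : ι × ℤ =>
    op B (.β ⁅x, B i.1⁆ (n + i.2)) * op B (.c (B.coord i.1) (-i.2))) (θPrim B x n) :=
  HasLocSum.congr (hasLocSum_locSum _) fun _ => nord_β_c B _ _ _ _

theorem hasLocSum_QPrim : HasLocSum (fun s : (ι × ι) × ℤ × ℤ =>
    op B (.β ⁅B s.1.1, B s.1.2⁆ (s.2.1 + s.2.2)) * (op B (.c (B.coord s.1.2) (-s.2.1)) *
      op B (.c (B.coord s.1.1) (-s.2.2)))) (QPrim B) :=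
  HasLocSum.congr (hasLocSum_locSum _) fun _ => nord_β_c_c B _ _ _ _ _ _

/-- Exchange of the two summation indices of a double sum over the loop algebra. -/
def swapIndex (ι : Type*) : (ι × ι) × ℤ × ℤ ≃ (ι × ι) × ℤ × ℤ :=
  Equiv.prodCongr (Equiv.prodComm _ _) (Equiv.prodComm _ _)

/-- The pair of summation indices `((u, j), (v, i))` of a double sum over the loop algebra. -/
def pairIndex (ι : Type*) : (ι × ℤ) × (ι × ℤ) ≃ (ι × ι) × ℤ × ℤ :=
  (Equiv.prodProdProdComm ι ℤ ι ℤ).trans (Equiv.prodCongr (Equiv.refl _) (Equiv.prodComm _ _))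

theorem hasLocSum_two_smul_Q [CharZero K] : HasLocSum (fun s : (ι × ι) × ℤ × ℤ =>
    h B * (op B (.β ⁅B s.1.1, B s.1.2⁆ (s.2.1 + s.2.2)) * (op B (.c (B.coord s.1.2) (-s.2.1)) *
      op B (.c (B.coord s.1.1) (-s.2.2))))
    - op B (.β ⁅B s.1.1, B s.1.2⁆ (s.2.1 + s.2.2)) * (op B (.c (B.coord s.1.2) (-s.2.1)) *
      op B (.c (B.coord s.1.1) (-s.2.2))) * h B) ((2 : K) • Q B) := by
  have h1 : HasLocSum _ (Qβγc B) := hasLocSum_locSum _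
  have h2 : HasLocSum _ (Qbcc B) := hasLocSum_locSum _
  rw [two_smul_Q]
  -- One of the two copies of `Qβγc` is reindexed by exchanging (u, j) with (v, i). Since [v,u] =
  -- -[u,v], this yields the antisymmetrized expression that is a boundary.
  refine ((h1.add (h1.comp_equiv (swapIndex ι))).add h2).congr fun s => ?_
  rw [← nord_β_γ_c_sub_add_nord_b_c_c, sub_eq_add_neg]
  congr 2
  simp only [swapIndex, Equiv.prodCongr_apply, Prod.map, Equiv.prodComm_apply, Prod.fst_swap,
    Prod.snd_swap]
  rw [← lie_skew, add_comm s.2.2, nord_β_cons, nord_β_cons, op_β_neg]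
  split_ifs
  · exact end_neg_mul _ _
  · exact end_mul_neg _ _

theorem two_smul_Q_eq [CharZero K] : (2 : K) • Q B = h B * QPrim B - QPrim B * h B :=
  (hasLocSum_two_smul_Q B).unique
    (((hasLocSum_QPrim B).mul_left (h B)).sub ((hasLocSum_QPrim B).mul_right (h B)))

omit [Fintype ι] in
theorem eq_of_two_smul_eq [CharZero K] {x y : Module.End K (W K ι)}
    (hxy : (2 : K) • x = (2 : K) • y) : x = y :=
  smul_right_injective _ (two_ne_zero (α := K)) hxy

theorem Q_mul_h [CharZero K] : Q B * h B = -(h B * Q B) := by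
  refine eq_of_two_smul_eq ?_
  rw [end_smul_neg, ← smul_mul_assoc, ← mul_smul_comm, two_smul_Q_eq]
  linear_combination (norm := noncomm_ring [smul_mul_assoc, mul_smul_comm])
    h_mul_h B * QPrim B - QPrim B * h_mul_h B

theorem k_mul_Q [CharZero K] : k B * Q B = -(Q B * k B) := by
  suffices key : k B * ((2 : K) • Q B) = -(((2 : K) • Q B) * k B) by
    rw [mul_smul_comm, smul_mul_assoc, ← end_smul_neg] at key
    exact eq_of_two_smul_eq key
  refine (hasLocSum_two_smul_Q B).anticommute fun s => ?_
  generalize hx : ⁅B s.1.1, B s.1.2⁆ = x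
  generalize hf : B.coord s.1.2 = f
  generalize hg : B.coord s.1.1 = g
  generalize s.2.1 = i
  generalize s.2.2 = j
  have h1 := hk_mul_β B x (i + j)
  have h2 := hk_mul_c B f (-i)
  have h3 := hk_mul_c B g (-j)
  rw [Int.cast_neg, end_neg_smul] at h2 h3
  rw [Int.cast_add, add_smul] at h1
  have h4 : hk B * (op B (.β x (i + j)) * (op B (.c f (-i)) * op B (.c g (-j))))
      = op B (.β x (i + j)) * (op B (.c f (-i)) * op B (.c g (-j))) * hk B := by
    linear_combination (norm := noncomm_ring [smul_mul_assoc, mul_smul_comm])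
      h1 * op B (.c f (-i)) * op B (.c g (-j)) + op B (.β x (i + j)) * h2 * op B (.c g (-j))
      + op B (.β x (i + j)) * op B (.c f (-i)) * h3
  have h5 : k B * (op B (.β x (i + j)) * (op B (.c f (-i)) * op B (.c g (-j))))
      = op B (.β x (i + j)) * (op B (.c f (-i)) * op B (.c g (-j))) * k B := by
    linear_combination (norm := noncomm_ring [smul_mul_assoc, mul_smul_comm])
      k_mul_β B x (i + j) * op B (.c f (-i)) * op B (.c g (-j))
      + op B (.β x (i + j)) * k_mul_c B f (-i) * op B (.c g (-j))
      - op B (.β x (i + j)) * op B (.c f (-i)) * k_mul_c B g (-j)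
  simp only [hk] at h4
  -- With P the word βcc and kP = Pk, the anticommutator of `k` with hP - Ph equals [hk + kh, P],
  -- which is zero because the indices i + j, -i, -j add up to 0.
  linear_combination (norm := noncomm_ring [smul_mul_assoc, mul_smul_comm])
    h4 - h B * h5 - h5 * h B

theorem c_mul_θPrim (x : ℓ) (n : ℤ) (f : Module.Dual K ℓ) (m : ℤ) :
    op B (.c f m) * θPrim B x n = -(θPrim B x n * op B (.c f m)) := by
  refine (hasLocSum_θPrim B x n).anticommute fun i => ?_
  linear_combination (norm := noncomm_ring [smul_mul_assoc, mul_smul_comm])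
    op B (.β ⁅x, B i.1⁆ (n + i.2)) * op_c_mul_op_c B f (B.coord i.1) m (-i.2)
    - op_β_c B f ⁅x, B i.1⁆ (n + i.2) m * op B (.c (B.coord i.1) (-i.2))

theorem QPrim_mul_c (f : Module.Dual K ℓ) (n : ℤ) :
    QPrim B * op B (.c f n) = op B (.c f n) * QPrim B := by
  refine ((hasLocSum_QPrim B).commute fun s => ?_).symm
  have h1 := op_c_mul_op_c B f (B.coord s.1.2) n (-s.2.1)
  have h2 := op_c_mul_op_c B f (B.coord s.1.1) n (-s.2.2)
  linear_combination (norm := noncomm_ring [smul_mul_assoc, mul_smul_comm])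
    op B (.β ⁅B s.1.1, B s.1.2⁆ (s.2.1 + s.2.2)) * h1 * op B (.c (B.coord s.1.1) (-s.2.2))
    - op B (.β ⁅B s.1.1, B s.1.2⁆ (s.2.1 + s.2.2)) * op B (.c (B.coord s.1.2) (-s.2.1)) * h2
    - op_β_c B f ⁅B s.1.1, B s.1.2⁆ (s.2.1 + s.2.2) n * op B (.c (B.coord s.1.2) (-s.2.1))
      * op B (.c (B.coord s.1.1) (-s.2.2))

theorem Qβγc_mul_c (f : Module.Dual K ℓ) (n : ℤ) :
    Qβγc B * op B (.c f n) = -(op B (.c f n) * Qβγc B) := by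
  have hQ : HasLocSum _ (Qβγc B) := hasLocSum_locSum _
  refine neg_eq_iff_eq_neg.mp (hQ.anticommute fun s => ?_).symm
  rw [nord_β_cons, nord_γ_c]
  have h1 := op_γ_mul_op_c B (B.coord s.1.2) f (-s.2.1) n
  have h2 := op_c_mul_op_c B f (B.coord s.1.1) n (-s.2.2)
  have h3 := op_β_c B f ⁅B s.1.1, B s.1.2⁆ (s.2.1 + s.2.2) n
  split_ifs
  · linear_combination (norm := noncomm_ring [smul_mul_assoc, mul_smul_comm])
      -(h3 * op B (.γ (B.coord s.1.2) (-s.2.1)) * op B (.c (B.coord s.1.1) (-s.2.2)))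
      - op B (.β ⁅B s.1.1, B s.1.2⁆ (s.2.1 + s.2.2)) * h1 * op B (.c (B.coord s.1.1) (-s.2.2))
      + op B (.β ⁅B s.1.1, B s.1.2⁆ (s.2.1 + s.2.2)) * op B (.γ (B.coord s.1.2) (-s.2.1)) * h2
  · linear_combination (norm := noncomm_ring [smul_mul_assoc, mul_smul_comm])
      op B (.γ (B.coord s.1.2) (-s.2.1)) * op B (.c (B.coord s.1.1) (-s.2.2)) * h3
      - h1 * op B (.c (B.coord s.1.1) (-s.2.2)) * op B (.β ⁅B s.1.1, B s.1.2⁆ (s.2.1 + s.2.2))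
      + op B (.γ (B.coord s.1.2) (-s.2.1)) * h2 * op B (.β ⁅B s.1.1, B s.1.2⁆ (s.2.1 + s.2.2))

end Primitives

/-! ### Q² = 0 from the Jacobi identity. -/

section SquareZero

variable {K : Type*} [Field K] {ℓ : Type*} [LieRing ℓ] [LieAlgebra K ℓ]
  {ι : Type*} [Fintype ι] (B : Module.Basis ι K ℓ)

omit [Fintype ι] in
theorem HasLocSum.sum {I J : Type*} (s : Finset J) {T : J → I → Module.End K (W K ι)}
    {S : J → Module.End K (W K ι)} (hS : ∀ j, HasLocSum (T j) (S j)) :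
    HasLocSum (fun i => ∑ j ∈ s, T j i) (∑ j ∈ s, S j) := by
  classical
  induction s using Finset.induction_on with
  | empty => exact fun w => by simp
  | insert a s ha ih =>
    simp only [Finset.sum_insert ha]
    exact (hS a).add ih

theorem sum_smul_op_β_lie (y z : ℓ) (n : ℤ) :
    ∑ u, B.coord u y • op B (.β ⁅B u, z⁆ n) = op B (.β ⁅y, z⁆ n) := by
  have h1 : ⁅y, z⁆ = ∑ u, B.coord u y • ⁅B u, z⁆ := by
    conv_lhs => rw [← B.sum_repr y, sum_lie]
    simp only [smul_lie, Module.Basis.coord_apply]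
  have h2 := map_sum (opβLin B n) (fun u => B.coord u y • ⁅B u, z⁆) Finset.univ
  rw [← h1] at h2
  simp only [map_smul] at h2
  exact h2.symm

theorem sum_smul_op_β_lie' (y z : ℓ) (n : ℤ) :
    ∑ u, B.coord u y • op B (.β ⁅z, B u⁆ n) = op B (.β ⁅z, y⁆ n) := by
  have h1 := sum_smul_op_β_lie B y z n
  have e : ∀ u, op B (.β ⁅z, B u⁆ n) = - op B (.β ⁅B u, z⁆ n) := fun u => by
    rw [← lie_skew, op_β_neg]
  simp only [e]
  rw [← lie_skew, op_β_neg, ← h1, ← Finset.sum_neg_distrib]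
  exact Finset.sum_congr rfl fun u _ => end_smul_neg _ _

theorem sum_smul_θPrim (y : ℓ) (m : ℤ) :
    ∑ u, B.coord u y • θPrim B (B u) m = θPrim B y m := by
  refine HasLocSum.unique (HasLocSum.sum Finset.univ fun u =>
    (hasLocSum_θPrim B (B u) m).smul (B.coord u y)) ((hasLocSum_θPrim B y m).congr fun i => ?_)
  simp only [← smul_mul_assoc]
  rw [← Finset.sum_mul, sum_smul_op_β_lie]

/-- Summing over (v, i) for fixed (u, j) exhibits QPrim as ∑ θPrim(u_j) c_{-j}^{u'}, so its bracket
with b can be computed from that of `θPrim`. -/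
theorem hasLocSum_θPrim_mul_c : HasLocSum (fun a : ι × ℤ =>
    θPrim B (B a.1) a.2 * op B (.c (B.coord a.1) (-a.2))) (QPrim B) := by
  refine ((hasLocSum_QPrim B).comp_equiv (pairIndex ι)).fiberwise fun a =>
    ((hasLocSum_θPrim B (B a.1) a.2).mul_right _).congr fun b => ?_
  simp only [pairIndex, Equiv.trans_apply, Equiv.prodProdProdComm_apply, Equiv.prodCongr_apply,
    Prod.map, Equiv.refl_apply, Equiv.prodComm_apply, Prod.swap]
  rw [mul_assoc, add_comm]

theorem θPrim_mul_b (x y : ℓ) (n m : ℤ) :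
    θPrim B x n * op B (.b y m) = -(op B (.b y m) * θPrim B x n) + op B (.β ⁅x, y⁆ (n + m)) := by
  have h1 := ((hasLocSum_θPrim B x n).mul_right (op B (.b y m))).add
    ((hasLocSum_θPrim B x n).mul_left (op B (.b y m)))
  have h2 := HasLocSum.ite_snd (fun u => B.coord u y • op B (.β ⁅x, B u⁆ (n + m))) m
  rw [sum_smul_op_β_lie'] at h2
  refine eq_neg_add_of_add_eq ((add_comm _ _).trans (h1.unique (h2.congr fun i => ?_)))
  have e : (if -i.2 + m = 0 then B.coord i.1 y else 0) • op B (.β ⁅x, B i.1⁆ (n + i.2))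
      = if i.2 = m then B.coord i.1 y • op B (.β ⁅x, B i.1⁆ (n + m)) else 0 := by
    by_cases hi : i.2 = m
    · simp [hi]
    · rw [if_neg hi, if_neg (by omega), zero_smul]
  rw [← e]
  linear_combination (norm := noncomm_ring [smul_mul_assoc, mul_smul_comm])
    -(op B (.β ⁅x, B i.1⁆ (n + i.2)) * op_c_mul_op_b B (B.coord i.1) y (-i.2) m)
    + op_β_mul_op_b B ⁅x, B i.1⁆ y (n + i.2) m * op B (.c (B.coord i.1) (-i.2))

/-- Either c in βcc may contract with b, and by antisymmetry of the bracket both contractions give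
the same `θPrim`. -/
theorem QPrim_mul_b (y : ℓ) (m : ℤ) :
    QPrim B * op B (.b y m) = op B (.b y m) * QPrim B + (θPrim B y m + θPrim B y m) := by
  have h1 := ((hasLocSum_θPrim_mul_c B).mul_right (op B (.b y m))).sub
    ((hasLocSum_θPrim_mul_c B).mul_left (op B (.b y m)))
  have h2 := HasLocSum.ite_snd (fun u => B.coord u y • θPrim B (B u) m) m
  rw [sum_smul_θPrim] at h2
  refine eq_add_of_sub_eq' (h1.unique ((h2.add (hasLocSum_θPrim B y m)).congr fun i => ?_))
  have e : (if -i.2 + m = 0 then B.coord i.1 y else 0) • θPrim B (B i.1) i.2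
      = if i.2 = m then B.coord i.1 y • θPrim B (B i.1) m else 0 := by
    by_cases hi : i.2 = m
    · simp [hi]
    · rw [if_neg hi, if_neg (by omega), zero_smul]
  have h3 := θPrim_mul_b B (B i.1) y i.2 m
  rw [← lie_skew, op_β_neg, add_comm i.2 m] at h3
  rw [← e]
  linear_combination (norm := noncomm_ring [smul_mul_assoc, mul_smul_comm])
    -(θPrim B (B i.1) i.2 * op_c_mul_op_b B (B.coord i.1) y (-i.2) m)
    + h3 * op B (.c (B.coord i.1) (-i.2))

theorem Qβγc_mul_β (y : ℓ) (m : ℤ) :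
    Qβγc B * op B (.β y m) = op B (.β y m) * Qβγc B - θPrim B y m := by
  have hQ : HasLocSum _ (Qβγc B) := hasLocSum_locSum _
  have h1 := ((hQ.mul_right (op B (.β y m))).sub (hQ.mul_left (op B (.β y m))))
  -- The only contraction is of γ_{-i}^{v'} with β_m^y; summing over (v, i) replaces v by y and i by
  -- m, leaving a sum over (u, j).
  have h2 := (h1.comp_equiv (pairIndex ι)).fiberwise (F := fun a =>
      op B (.β ⁅B a.1, y⁆ (m + a.2)) * op B (.c (B.coord a.1) (-a.2))) fun a => by
    have h3 := (HasLocSum.ite_snd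
      (fun v => B.coord v y • op B (.β ⁅B a.1, B v⁆ (m + a.2))) m).mul_right
        (op B (.c (B.coord a.1) (-a.2)))
    rw [sum_smul_op_β_lie'] at h3
    refine h3.congr fun b => ?_
    have e : (if -b.2 + m = 0 then B.coord b.1 y else 0) • op B (.β ⁅B a.1, B b.1⁆ (b.2 + a.2))
        = if b.2 = m then B.coord b.1 y • op B (.β ⁅B a.1, B b.1⁆ (m + a.2)) else 0 := by
      by_cases hi : b.2 = m
      · simp [hi]
      · rw [if_neg hi, if_neg (by omega), zero_smul]
    simp only [pairIndex, Equiv.trans_apply, Equiv.prodProdProdComm_apply, Equiv.prodCongr_apply,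
      Prod.map, Equiv.refl_apply, Equiv.prodComm_apply, Prod.swap]
    rw [← e, nord_β_cons, nord_γ_c]
    have h4 := op_γ_mul_op_β B (B.coord b.1) y (-b.2) m
    have h5 := op_β_c B (B.coord a.1) y m (-a.2)
    have h6 := op_β_mul_op_β B ⁅B a.1, B b.1⁆ y (b.2 + a.2) m
    by_cases hp : b.2 + a.2 ≤ -1
    · rw [if_pos hp]
      linear_combination (norm := noncomm_ring [smul_mul_assoc, mul_smul_comm])
        op B (.β ⁅B a.1, B b.1⁆ (b.2 + a.2)) * op B (.γ (B.coord b.1) (-b.2)) * h5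
        - op B (.β ⁅B a.1, B b.1⁆ (b.2 + a.2)) * h4 * op B (.c (B.coord a.1) (-a.2))
        - h6 * op B (.γ (B.coord b.1) (-b.2)) * op B (.c (B.coord a.1) (-a.2))
    · rw [if_neg hp]
      have h7 := op_β_c B (B.coord a.1) ⁅B a.1, B b.1⁆ (b.2 + a.2) (-a.2)
      linear_combination (norm := noncomm_ring [smul_mul_assoc, mul_smul_comm])
        -(op B (.γ (B.coord b.1) (-b.2)) * op B (.c (B.coord a.1) (-a.2)) * h6)
        + op B (.γ (B.coord b.1) (-b.2)) * h5 * op B (.β ⁅B a.1, B b.1⁆ (b.2 + a.2))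
        - h4 * op B (.c (B.coord a.1) (-a.2)) * op B (.β ⁅B a.1, B b.1⁆ (b.2 + a.2))
        + (if -b.2 + m = 0 then B.coord b.1 y else 0) • h7
  have h4 := h2.unique ((hasLocSum_θPrim B y m).neg.congr fun a => by
    rw [← lie_skew, op_β_neg, end_neg_mul, neg_neg])
  linear_combination (norm := noncomm_ring [smul_mul_assoc, mul_smul_comm]) h4

/-- Cyclic permutation of the three summation indices of a triple sum over the loop algebra. -/
def cycleIndex (ι : Type*) : ((ι × ι) × ℤ × ℤ) × (ι × ℤ) ≃ ((ι × ι) × ℤ × ℤ) × (ι × ℤ) where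
  toFun t := (((t.1.1.2, t.2.1), (t.2.2, t.1.2.1)), (t.1.1.1, t.1.2.2))
  invFun t := (((t.2.1, t.1.1.1), (t.1.2.2, t.2.2)), (t.1.1.2, t.1.2.1))
  left_inv _ := rfl
  right_inv _ := rfl

theorem locFin_jacobi : LocFin fun t : ((ι × ι) × ℤ × ℤ) × (ι × ℤ) =>
    nord B [.β ⁅⁅B t.1.1.1, B t.1.1.2⁆, B t.2.1⁆ (t.1.2.1 + t.1.2.2 + t.2.2),
      .c (B.coord t.2.1) (-t.2.2), .c (B.coord t.1.1.2) (-t.1.2.1),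
      .c (B.coord t.1.1.1) (-t.1.2.2)] := by
  intro w
  obtain ⟨N, hN, hw⟩ := exists_bounded w
  -- If no mode has index above N, then i, j, k ≥ -N and i + j + k ≤ N, so each of them is at most
  -- 3N.
  refine (((Set.finite_univ (α := ι × ι)).prod
    ((Set.finite_Icc (-N) (3 * N)).prod (Set.finite_Icc (-N) (3 * N)))).prod
    ((Set.finite_univ (α := ι)).prod (Set.finite_Icc (-N) (3 * N)))).subset ?_
  rintro ⟨⟨⟨u, v⟩, i, j⟩, x, k⟩ h
  by_contra hm
  apply h
  refine nord_eq_zero B hN _ hw ?_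
  simp only [List.mem_cons, List.not_mem_nil, or_false, exists_eq_or_imp, exists_eq_left, Mode.idx]
  simp only [Set.mem_prod, Set.mem_univ, true_and, Set.mem_Icc, not_and_or, not_le] at hm
  omega

variable [CharZero K]

/-- A cyclic permutation of three anticommuting c's is even. Hence the three cyclic reindexings of
the sum add up to β of the Jacobi expression times one word ccc, and three times the sum is zero. -/
theorem locSum_jacobi : locSum _ (locFin_jacobi B) = 0 := by
  set X := locSum _ (locFin_jacobi B) with hX
  have h1 := (hasLocSum_locSum (locFin_jacobi B)).congr fun t => nord_β_c_c_c B _ _ _ _ _ _ _ _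
  rw [← hX] at h1
  have h2 := (h1.add (h1.comp_equiv (cycleIndex ι))).add
    (h1.comp_equiv ((cycleIndex ι).trans (cycleIndex ι)))
  have h3 : HasLocSum (fun _ : ((ι × ι) × ℤ × ℤ) × (ι × ℤ) => (0 : Module.End K (W K ι))) 0 :=
    fun w => by simp
  have h4 : X + X + X = 0 := by
    refine h2.unique (h3.congr fun t => ?_)
    obtain ⟨⟨⟨u, v⟩, i, j⟩, x, k⟩ := t
    simp only [cycleIndex, Equiv.trans_apply, Equiv.coe_fn_mk]
    have e1 : k + i + j = i + j + k := by ring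
    have e2 : j + k + i = i + j + k := by ring
    rw [e1, e2]
    have c1 := op_c_mul_op_c B (B.coord v) (B.coord u) (-i) (-j)
    have c2 := op_c_mul_op_c B (B.coord x) (B.coord u) (-k) (-j)
    have c3 := op_c_mul_op_c B (B.coord x) (B.coord v) (-k) (-i)
    have hj : op B (.β ⁅⁅B u, B v⁆, B x⁆ (i + j + k)) + op B (.β ⁅⁅B v, B x⁆, B u⁆ (i + j + k))
        + op B (.β ⁅⁅B x, B u⁆, B v⁆ (i + j + k)) = 0 := by
      rw [← op_β_add, ← op_β_add, ← op_β_zero B (i + j + k)]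
      congr 2
      rw [← lie_skew, ← lie_skew ⁅B v, B x⁆, ← lie_skew ⁅B x, B u⁆, ← neg_add, ← neg_add, neg_eq_zero,
        ← lie_jacobi (B x) (B u) (B v)]
    linear_combination (norm := noncomm_ring [smul_mul_assoc, mul_smul_comm])
      -(hj * op B (.c (B.coord x) (-k)) * op B (.c (B.coord v) (-i)) * op B (.c (B.coord u) (-j)))
      - op B (.β ⁅⁅B v, B x⁆, B u⁆ (i + j + k))
        * (c2 * op B (.c (B.coord v) (-i)) - op B (.c (B.coord x) (-k)) * c1)
      - op B (.β ⁅⁅B x, B u⁆, B v⁆ (i + j + k))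
        * (op B (.c (B.coord v) (-i)) * c2 - c3 * op B (.c (B.coord u) (-j)))
  have h5 : (3 : K) • X = 0 := by
    rw [show (3 : K) = 1 + 1 + 1 by norm_num, add_smul, add_smul, one_smul, h4]
  exact (smul_eq_zero.mp h5).resolve_left three_ne_zero

/-- Expanding `θPrim` turns this into the triple sum of `locSum_jacobi`. It is the obstruction to
commuting either part of Q with QPrim. -/
theorem hasLocSum_θPrim_mul_c_mul_c : HasLocSum (fun s : (ι × ι) × ℤ × ℤ =>
    θPrim B ⁅B s.1.1, B s.1.2⁆ (s.2.1 + s.2.2) * (op B (.c (B.coord s.1.2) (-s.2.1)) *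
      op B (.c (B.coord s.1.1) (-s.2.2)))) 0 := by
  have h1 := (hasLocSum_locSum (locFin_jacobi B)).congr fun t => nord_β_c_c_c B _ _ _ _ _ _ _ _
  rw [locSum_jacobi] at h1
  refine h1.fiberwise fun s => ((hasLocSum_θPrim B _ _).mul_right _).congr fun i => ?_
  rw [mul_assoc]

theorem Qβγc_mul_QPrim : Qβγc B * QPrim B = QPrim B * Qβγc B := by
  have h1 := ((hasLocSum_QPrim B).mul_left (Qβγc B)).sub ((hasLocSum_QPrim B).mul_right (Qβγc B))
  have h2 := h1.unique ((hasLocSum_θPrim_mul_c_mul_c B).neg.congr fun s => by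
    have h3 := Qβγc_mul_β B ⁅B s.1.1, B s.1.2⁆ (s.2.1 + s.2.2)
    have h4 := Qβγc_mul_c B (B.coord s.1.2) (-s.2.1)
    have h5 := Qβγc_mul_c B (B.coord s.1.1) (-s.2.2)
    linear_combination (norm := noncomm_ring [smul_mul_assoc, mul_smul_comm])
      -(h3 * op B (.c (B.coord s.1.2) (-s.2.1)) * op B (.c (B.coord s.1.1) (-s.2.2)))
      - op B (.β ⁅B s.1.1, B s.1.2⁆ (s.2.1 + s.2.2)) * h4 * op B (.c (B.coord s.1.1) (-s.2.2))
      + op B (.β ⁅B s.1.1, B s.1.2⁆ (s.2.1 + s.2.2)) * op B (.c (B.coord s.1.2) (-s.2.1)) * h5)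
  linear_combination (norm := noncomm_ring) h2

theorem Qbcc_mul_QPrim : Qbcc B * QPrim B = QPrim B * Qbcc B := by
  have hQ : HasLocSum _ (Qbcc B) := hasLocSum_locSum _
  have h1 := (hQ.mul_right (QPrim B)).sub (hQ.mul_left (QPrim B))
  have h0 := hasLocSum_θPrim_mul_c_mul_c B
  -- The obstruction occurs twice because `QPrim_mul_b` produces `θPrim` twice.
  have h2 := h1.unique ((h0.add h0).neg.congr fun s => by
    rw [nord_b_c_c]
    generalize ⁅B s.1.1, B s.1.2⁆ = x
    generalize B.coord s.1.1 = f
    generalize B.coord s.1.2 = g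
    generalize s.2.1 + s.2.2 = n
    have h3 := QPrim_mul_b B x n
    have h4 := QPrim_mul_c B g (-s.2.1)
    have h5 := QPrim_mul_c B f (-s.2.2)
    split_ifs
    · linear_combination (norm := noncomm_ring [smul_mul_assoc, mul_smul_comm])
        h3 * op B (.c g (-s.2.1)) * op B (.c f (-s.2.2))
        + op B (.b x n) * h4 * op B (.c f (-s.2.2))
        + op B (.b x n) * op B (.c g (-s.2.1)) * h5
    -- When b is an annihilation operator it stands on the right, so `θPrim` appears behind both c's
    -- and is moved in front with two cancelling signs.
    · have h6 := c_mul_θPrim B x n g (-s.2.1)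
      have h7 := c_mul_θPrim B x n f (-s.2.2)
      linear_combination (norm := noncomm_ring [smul_mul_assoc, mul_smul_comm])
        op B (.c g (-s.2.1)) * op B (.c f (-s.2.2)) * h3
        + op B (.c g (-s.2.1)) * h5 * op B (.b x n)
        + h4 * op B (.c f (-s.2.2)) * op B (.b x n)
        + (2 : ℤ) • (op B (.c g (-s.2.1)) * h7 - h6 * op B (.c f (-s.2.2))))
  linear_combination (norm := noncomm_ring) h2

theorem Q_mul_QPrim : Q B * QPrim B = QPrim B * Q B := by
  rw [Q_eq, add_mul, mul_add, Qβγc_mul_QPrim, smul_mul_assoc, mul_smul_comm, Qbcc_mul_QPrim]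

theorem Q_mul_Q : Q B * Q B = 0 := by
  have h1 : (2 : K) • (Q B * Q B) = Q B * (h B * QPrim B - QPrim B * h B) := by
    rw [← two_smul_Q_eq, mul_smul_comm]
  have h2 : (2 : K) • (Q B * Q B) = (h B * QPrim B - QPrim B * h B) * Q B := by
    rw [← two_smul_Q_eq, smul_mul_assoc]
  have h3 : (2 : K) • (Q B * Q B) = - ((2 : K) • (Q B * Q B)) := by
    linear_combination (norm := noncomm_ring [smul_mul_assoc, mul_smul_comm])
      h1 + h2 + Q_mul_h B * QPrim B - QPrim B * Q_mul_h B
      - h B * Q_mul_QPrim B - Q_mul_QPrim B * h B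
  exact (smul_eq_zero.mp (eq_zero_of_eq_neg_self (K := K) h3)).resolve_left two_ne_zero

end SquareZero

end VOWA

/-- On the semi-infinite Weil complex of the loop algebra of `ℓ`, in terms of supercommutators:
`Q`, `h`, `k` are odd, `L n` and `θ x n` are even. -/
theorem proposition1 {K : Type*} [Field K] [IsAlgClosed K] [CharZero K]
    {ℓ : Type*} [LieRing ℓ] [LieAlgebra K ℓ]
    {ι : Type*} [Fintype ι] (B : Module.Basis ι K ℓ) :
    VOWA.Q B * VOWA.h B + VOWA.h B * VOWA.Q B = 0 ∧
    VOWA.Q B * VOWA.k B + VOWA.k B * VOWA.Q B = 0 ∧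
    VOWA.h B * VOWA.k B + VOWA.k B * VOWA.h B = - VOWA.L B 0 ∧
    (∀ n : ℤ, VOWA.h B * VOWA.L B n - VOWA.L B n * VOWA.h B = 0) ∧
    VOWA.k B * VOWA.L B 0 - VOWA.L B 0 * VOWA.k B = 0 ∧
    (∀ (x : ℓ) (n : ℤ), VOWA.h B * VOWA.θ B x n - VOWA.θ B x n * VOWA.h B = 0) ∧
    (∀ x : ℓ, VOWA.k B * VOWA.θ B x 0 - VOWA.θ B x 0 * VOWA.k B = 0) ∧
    VOWA.Q B * VOWA.Q B = 0 ∧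
    VOWA.h B * VOWA.h B = 0 ∧
    VOWA.k B * VOWA.k B = 0 := by
  refine ⟨?_, ?_, VOWA.h_mul_k_add_k_mul_h B, fun n => sub_eq_zero.mpr (VOWA.h_mul_L B n),
    sub_eq_zero.mpr (VOWA.k_mul_L_zero B), fun x n => sub_eq_zero.mpr (VOWA.h_mul_θ B x n),
    fun x => sub_eq_zero.mpr (VOWA.k_mul_θ_zero B x), VOWA.Q_mul_Q B, VOWA.h_mul_h B,
    VOWA.k_mul_k B⟩
  · rw [VOWA.Q_mul_h, neg_add_cancel]
  · rw [VOWA.k_mul_Q, add_neg_cancel]
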